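/- **Conventions.** $\mathsf C$ is a monoidal category with unit $I$; the monoidal product is written as juxtaposition and the coherence isomorphisms are suppressed. $f.g$ is the composite "first $g$, then $f$"; identity morphisms are written $1$ or $=$. Monoids have multiplication $m$ and unit $u$; $I$ is regarded as the trivial monoid. A class $\mathcal S$ of spans in a category is *admissible* if, for every span $X\xleftarrow{f}A\xrightarrow{g}Y$ in $\mathcal S$, also $X'\xleftarrow{f'.f}A\xrightarrow{g'.g}Y'$ and $X\xleftarrow{f.h}A'\xrightarrow{g.h}Y$ are in $\mathcal S$ for all morphisms $f':X\to X'$, $g':Y\to Y'$, $h:A'\to A$. An admissible class of spans in $\mathsf C$ is *monoidal* if $I=I=I$ is in $\mathcal S$ and if with $X\xleftarrow{f}A\xrightarrow{g}Y$ and $X'\xleftarrow{f'}A'\xrightarrow{g'}Y'$ also $XX'\xleftarrow{ff'}AA'\xrightarrow{gg'}YY'$ is in $\mathcal S$. An *$\mathcal S$-relative pullback* of a cospan $A\xrightarrow{f}B\xleftarrow{g}C$ is a span $A\xleftarrow{p_A}A\Box_B C\xrightarrow{p_C}C$ in $\mathcal S$ with $f.p_A=g.p_C$ such that (universality) for every span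 $A\xleftarrow{a}X\xrightarrow{c}C$ in $\mathcal S$ with $f.a=g.c$ there is a unique $h:X\to A\Box_B C$ with $p_A.h=a$ and $p_C.h=c$, and (reflection) if for $h:X\to A\Box_BC$ and $k:X\to Z$ both spans $(p_A.h,k)$, $(p_C.h,k)$ are in $\mathcal S$, then so is $(h,k)$; and symmetrically, if $(k,p_A.h)$ and $(k,p_C.h)$ are in $\mathcal S$, then so is $(k,h)$. Wherever $a:X\to A$, $c:X\to C$ induce a morphism $h$ in this way, $h$ is said to have components $a$, $c$. The cospan has its *legs in $\mathcal S$* if the spans $A= A\xrightarrow{f}B$ and $B\xleftarrow{g}C= C$ are in $\mathcal S$; a span $X\xleftarrow{f}A\xrightarrow{g}Y$ has its legs in $\mathcal S$ if $X\xleftarrow{f}A=A$ and $A=A\xrightarrow{g}Y$ are in $\mathcal S$. **Standing hypotheses.** $\mathcal S$ is a monoidal admissible class of spans in $\mathsf C$ such that every cospan whose legs are in $\mathcal S$ has an $\mathcal S$-relative pullback. Also denote by $\mathcal S$ the induced class of spans in the category of monoids in $\mathsf C$: the spans of monoid morphisms whose underlying span in $\mathsf C$ is in $\mathcal S$. (The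 relative pullback of a cospan of monoids with legs in $\mathcal S$ is that in $\mathsf C$, with the unique monoid structure for which the projections are monoid morphisms.) **Relative categories.** An *$\mathcal S$-relative category* in the category of monoids consists of monoids $B,A$ and monoid morphisms $s,t:A\to B$, $i:B\to A$, $d:A\Box_BA\to A$ such that $B\xleftarrow{t}A\xrightarrow{s}B$ has its legs in $\mathcal S$ and $(A,d,i)$ is a monoid in the monoidal category of spans from $B$ to $B$ with legs in $\mathcal S$ (with product $\Box_B$ and unit $B=B=B$); here $A\Box_BA$ is the relative pullback of $A\xrightarrow{s}B\xleftarrow{t}A$, with projections $p_1,p_2$. Explicitly: $s.i=1=t.i$, $s.d=s.p_2$, $t.d=t.p_1$, $d.(i\Box 1)=1=d.(1\Box i)$ and $d.(d\Box 1)=d.(1\Box d)$ (up to the associativity isomorphism). An *$\mathcal S$-relative functor* $(B,A,s,t,i,d)\to(B',A',s',t',i',d')$ is a pair of monoid morphisms $b:B\to B'$, $a:A\to A'$ with $s'.a=b.s$, $t'.a=b.t$, $i'.b=a.i$, $d'.(a\Box a)=a.d$. Put $A^{\Box 0}=B$, $A^{\Box 1}=A$ and $A^{\Box n+1}=A\Box_BA^{\Box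 n}$, and let $A\Box_BI$ be the relative pullback of $A\xrightarrow{s}B\xleftarrow{u}I$ with projection $p_A$ to $A$. For $n\ge 0$ put $$q_{n+1}:=\Big((A\Box_BI)A^{\Box n}\xrightarrow{p_A1}AA^{\Box n}\xrightarrow{(1\Box i\Box\cdots\Box i)(i\Box1\Box\cdots\Box1)}(A^{\Box n+1})^2\xrightarrow{m}A^{\Box n+1}\Big),$$ so that $q_1=m.p_Ai$. **Theorem.** The following two categories are equivalent. 1. $\mathsf{CatMon}_{\mathcal S}(\mathsf C)$: objects are the $\mathcal S$-relative categories in the category of monoids in $\mathsf C$ for which $q_n$ is invertible for every positive integer $n$; morphisms are the $\mathcal S$-relative functors. 2. $\mathsf{Xmod}_{\mathcal S}(\mathsf C)$: objects $(B,Y,e,k,x)$ consist of monoids $B$ and $Y$ in $\mathsf C$, monoid morphisms $e:Y\to I$ and $k:Y\to B$, and a distributive law $x:BY\to YB$ (that is, $x.m1=1m.x1.1x$, $x.1m=m1.1x.x1$, $x.u1=1u$, $x.1u=u1$), subject to the following conditions. - (a') $B\xleftarrow{k}Y=Y$, $Y=Y\xrightarrow{e}I$ and $B=B=B$ are in $\mathcal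 S$. - (b') $e1.x=1e$ and $m.k1.x=m.1k$. - (c') Invertible are: the morphism $f:Y\to YB\,\Box_BI$ with components $1u:Y\to YB$ and $e:Y\to I$ into the relative pullback of $YB\xrightarrow{e1}B\xleftarrow{u}I$; and, for all $n\ge0$, the morphism $b_{n+1}:Y^{n+1}B\to YB\,\Box_BY^nB$ with components $1m^{(n)}.1k\cdots k1:Y^{n+1}B\to YB$ and $e1\cdots1:Y^{n+1}B\to Y^nB$ into the relative pullback of $YB\xrightarrow{e1}B\xleftarrow{m^{(n)}.k\cdots k1}Y^nB$, where $m^{(n)}:B^{n+1}\to B$ is the iterated multiplication ($m^{(0)}=1$). - (d') With the monoid structure on $YB$ induced by $x$ (multiplication $mm.1x1$, unit $uu$), for which $e1$ and $m.k1:YB\to B$ are monoid morphisms, and the resulting multiplication $m$ on $YB\,\Box_BYB$, the composite $$YBY\xrightarrow{u111uu}(Y^2B)^2\xrightarrow{b_2b_2}(YB\,\Box_BYB)^2\xrightarrow{m}YB\,\Box_BYB\xrightarrow{b_2^{-1}}Y^2B\xrightarrow{m1}YB$$ is equal to $YBY\xrightarrow{1x}Y^2B\xrightarrow{m1}YB$.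 Morphisms $(B,Y,e,k,x)\to(B',Y',e',k',x')$ are pairs of monoid morphisms $b:B\to B'$, $y:Y\to Y'$ such that $e'.y=e$, $k'.y=b.k$ and $x'.by=yb.x$. -/

import Mathlib

open CategoryTheory MonoidalCategory MonObj

universe v u

set_option linter.unusedSectionVars false

namespace RelXmod

/-! ## Classes of spans and relative pullbacks -/

section Spans

/-- A class of spans `X ⟵ A ⟶ Y` in a category: `S f g` says that the span with left leg
`f : A ⟶ X` and right leg `g : A ⟶ Y` belongs to the class. -/
abbrev SpanClass (D : Type u) [Category.{v} D] : Type (max u v) :=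
  ∀ ⦃X A Y : D⦄, (A ⟶ X) → (A ⟶ Y) → Prop

variable {D : Type u} [Category.{v} D]

/-- Admissible classes of spans: closed under postcomposition of the two legs with arbitrary
morphisms, and under precomposition of both legs with the same arbitrary morphism. -/
class IsAdmissible (S : SpanClass D) : Prop where
  post : ∀ {X A Y X₁ Y₁ : D} {f : A ⟶ X} {g : A ⟶ Y} (_ : S f g) (f₁ : X ⟶ X₁) (g₁ : Y ⟶ Y₁),
    S (f ≫ f₁) (g ≫ g₁)
  pre : ∀ {X A Y A₁ : D} {f : A ⟶ X} {g : A ⟶ Y} (_ : S f g) (h : A₁ ⟶ A), S (h ≫ f) (h ≫ g)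

/-- The span `A ⟵p- P -q⟶ C` is a pullback of the cospan `A -f⟶ B ⟵g- C` relative to `S`:
it belongs to `S`, it makes the square commute, it is universal among the spans in `S` making
the square commute, and it reflects membership in `S`. -/
structure IsRelPullback (S : SpanClass D) {A B C P : D} (f : A ⟶ B) (g : C ⟶ B)
    (p : P ⟶ A) (q : P ⟶ C) : Prop where
  mem : S p q
  w : p ≫ f = q ≫ g
  existsUnique_lift : ∀ {X : D} (a : X ⟶ A) (c : X ⟶ C), S a c → a ≫ f = c ≫ g →
    ∃! h : X ⟶ P, h ≫ p = a ∧ h ≫ q = c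
  reflect_left : ∀ {X Z : D} (h : X ⟶ P) (k : X ⟶ Z), S (h ≫ p) k → S (h ≫ q) k → S h k
  reflect_right : ∀ {X Z : D} (k : X ⟶ Z) (h : X ⟶ P), S k (h ≫ p) → S k (h ≫ q) → S k h

/-- Every cospan `A -f⟶ B ⟵g- C` whose legs are in `S`, that is, for which the spans
`A = A -f⟶ B` and `B ⟵g- C = C` are in `S`, has a pullback relative to `S`. -/
def HasRelPullbacks (S : SpanClass D) : Prop :=
  ∀ {A B C : D} (f : A ⟶ B) (g : C ⟶ B), S (𝟙 A) f → S g (𝟙 C) →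
    ∃ (P : D) (p : P ⟶ A) (q : P ⟶ C), IsRelPullback S f g p q

/-- A choice of an `S`-relative pullback for every cospan whose legs are in `S`. -/
structure ChosenRelPullbacks (S : SpanClass D) where
  obj : ∀ {A B C : D} (f : A ⟶ B) (g : C ⟶ B), S (𝟙 A) f → S g (𝟙 C) → D
  fst : ∀ {A B C : D} (f : A ⟶ B) (g : C ⟶ B) (hf : S (𝟙 A) f) (hg : S g (𝟙 C)),
    obj f g hf hg ⟶ A
  snd : ∀ {A B C : D} (f : A ⟶ B) (g : C ⟶ B) (hf : S (𝟙 A) f) (hg : S g (𝟙 C)),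
    obj f g hf hg ⟶ C
  isRelPullback : ∀ {A B C : D} (f : A ⟶ B) (g : C ⟶ B) (hf : S (𝟙 A) f) (hg : S g (𝟙 C)),
    IsRelPullback S f g (fst f g hf hg) (snd f g hf hg)

/-- Choices of relative pullbacks exist exactly if relative pullbacks exist. -/
theorem nonempty_chosenRelPullbacks_iff (S : SpanClass D) :
    Nonempty (ChosenRelPullbacks S) ↔ HasRelPullbacks S := by
  constructor
  · rintro ⟨pb⟩ A B C f g hf hg
    exact ⟨_, _, _, pb.isRelPullback f g hf hg⟩
  · intro h
    choose P p q hP using @h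
    exact ⟨⟨fun f g hf hg => P f g hf hg, fun f g hf hg => p f g hf hg,
      fun f g hf hg => q f g hf hg, fun f g hf hg => hP f g hf hg⟩⟩

namespace IsRelPullback

variable {S : SpanClass D} {A B C P : D} {f : A ⟶ B} {g : C ⟶ B} {p : P ⟶ A} {q : P ⟶ C}

/-- The legs of a relative pullback are jointly monic. -/
theorem hom_ext [IsAdmissible S] (hP : IsRelPullback S f g p q) {X : D} {h k : X ⟶ P}
    (h₁ : h ≫ p = k ≫ p) (h₂ : h ≫ q = k ≫ q) : h = k :=
  (hP.existsUnique_lift (k ≫ p) (k ≫ q) (IsAdmissible.pre hP.mem k)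
    (by simp only [Category.assoc, hP.w])).unique ⟨h₁, h₂⟩ ⟨rfl, rfl⟩

end IsRelPullback

namespace ChosenRelPullbacks

variable {S : SpanClass D} (pb : ChosenRelPullbacks S) {A B C : D} {f : A ⟶ B} {g : C ⟶ B}
  (hf : S (𝟙 A) f) (hg : S g (𝟙 C))

/-- The morphism into the relative pullback that is induced by a span in `S`. -/
noncomputable def lift {X : D} (a : X ⟶ A) (c : X ⟶ C) (hac : S a c) (w : a ≫ f = c ≫ g) :
    X ⟶ pb.obj f g hf hg :=
  ((pb.isRelPullback f g hf hg).existsUnique_lift a c hac w).choose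

theorem lift_fst {X : D} (a : X ⟶ A) (c : X ⟶ C) (hac : S a c) (w : a ≫ f = c ≫ g) :
    pb.lift hf hg a c hac w ≫ pb.fst f g hf hg = a :=
  ((pb.isRelPullback f g hf hg).existsUnique_lift a c hac w).choose_spec.1.1

theorem lift_snd {X : D} (a : X ⟶ A) (c : X ⟶ C) (hac : S a c) (w : a ≫ f = c ≫ g) :
    pb.lift hf hg a c hac w ≫ pb.snd f g hf hg = c :=
  ((pb.isRelPullback f g hf hg).existsUnique_lift a c hac w).choose_spec.1.2

theorem hom_ext [IsAdmissible S] {X : D} {h k : X ⟶ pb.obj f g hf hg}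
    (h₁ : h ≫ pb.fst f g hf hg = k ≫ pb.fst f g hf hg)
    (h₂ : h ≫ pb.snd f g hf hg = k ≫ pb.snd f g hf hg) : h = k :=
  (pb.isRelPullback f g hf hg).hom_ext h₁ h₂

end ChosenRelPullbacks

end Spans

/-! ## Relative categories -/

section RelativeCategories

variable {D : Type u} [Category.{v} D]

/-- A reflexive graph `s, t : A ⇉ B`, `i : B ⟶ A` such that the span `B ⟵t- A -s⟶ B` has its
legs in `S`. -/
structure ReflGraph (S : SpanClass D) where
  B : D
  A : D
  s : A ⟶ B
  t : A ⟶ B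
  i : B ⟶ A
  i_s : i ≫ s = 𝟙 B
  i_t : i ≫ t = 𝟙 B
  mem_s : S (𝟙 A) s
  mem_t : S t (𝟙 A)

/-- An object `X` over `B` via `t : X ⟶ B`, with a section `j` of `t`, such that the span
`B ⟵t- X = X` is in `S`. (The relative powers of a reflexive graph will be of this kind.) -/
structure PointedOver (S : SpanClass D) (B : D) where
  X : D
  t : X ⟶ B
  j : B ⟶ X
  j_t : j ≫ t = 𝟙 B
  mem : S t (𝟙 X)

variable {S : SpanClass D}

namespace ReflGraph

variable [IsAdmissible S]

theorem mem_i (G : ReflGraph S) : S G.i (𝟙 G.B) := by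
  have h := IsAdmissible.pre G.mem_s G.i
  rwa [Category.comp_id, G.i_s] at h

/-- The span `B = B = B` is in `S`. -/
theorem mem_id (G : ReflGraph S) : S (𝟙 G.B) (𝟙 G.B) := by
  have h := IsAdmissible.post G.mem_i G.s (𝟙 _)
  rwa [G.i_s, Category.comp_id] at h

/-- `B` over itself. -/
abbrev unitOver (G : ReflGraph S) : PointedOver S G.B where
  X := G.B
  t := 𝟙 _
  j := 𝟙 _
  j_t := Category.comp_id _
  mem := G.mem_id

/-- `A` over `B` via `t`, with the section `i`. -/
abbrev selfOver (G : ReflGraph S) : PointedOver S G.B where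
  X := G.A
  t := G.t
  j := G.i
  j_t := G.i_t
  mem := G.mem_t

variable (pb : ChosenRelPullbacks S) (G : ReflGraph S) (P : PointedOver S G.B)

/-- The relative pullback `A □_B P` of `s : A ⟶ B` and `t : P ⟶ B`. -/
abbrev box : D := pb.obj G.s P.t G.mem_s P.mem

/-- The first projection `p₁ : A □_B P ⟶ A`. -/
abbrev p₁ : G.box pb P ⟶ G.A := pb.fst G.s P.t G.mem_s P.mem

/-- The second projection `p₂ : A □_B P ⟶ P`. -/
abbrev p₂ : G.box pb P ⟶ P.X := pb.snd G.s P.t G.mem_s P.mem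

/-- The morphism `a □ c : X ⟶ A □_B P` with components `a` and `c`. -/
noncomputable abbrev boxLift {X : D} (a : X ⟶ G.A) (c : X ⟶ P.X) (hac : S a c)
    (w : a ≫ G.s = c ≫ P.t) : X ⟶ G.box pb P :=
  pb.lift G.mem_s P.mem a c hac w

theorem box_mem : S (G.p₁ pb P) (G.p₂ pb P) := (pb.isRelPullback _ _ _ _).mem

theorem box_w : G.p₁ pb P ≫ G.s = G.p₂ pb P ≫ P.t := (pb.isRelPullback _ _ _ _).w

theorem boxLift_p₁ {X : D} (a : X ⟶ G.A) (c : X ⟶ P.X) (hac : S a c)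
    (w : a ≫ G.s = c ≫ P.t) : G.boxLift pb P a c hac w ≫ G.p₁ pb P = a :=
  pb.lift_fst G.mem_s P.mem a c hac w

theorem boxLift_p₂ {X : D} (a : X ⟶ G.A) (c : X ⟶ P.X) (hac : S a c)
    (w : a ≫ G.s = c ≫ P.t) : G.boxLift pb P a c hac w ≫ G.p₂ pb P = c :=
  pb.lift_snd G.mem_s P.mem a c hac w

theorem box_hom_ext {X : D} {h k : X ⟶ G.box pb P}
    (h₁ : h ≫ G.p₁ pb P = k ≫ G.p₁ pb P) (h₂ : h ≫ G.p₂ pb P = k ≫ G.p₂ pb P) : h = k :=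
  pb.hom_ext G.mem_s P.mem h₁ h₂

/-- `1 □ j : A ≅ A □_B B ⟶ A □_B P`, with components `1` and `j.s`. -/
noncomputable def oneBox : G.A ⟶ G.box pb P :=
  G.boxLift pb P (𝟙 _) (G.s ≫ P.j)
    (by
      have h := IsAdmissible.post G.mem_s (𝟙 _) P.j
      rwa [Category.comp_id] at h)
    (by rw [Category.assoc, P.j_t, Category.id_comp, Category.comp_id])

/-- `i □ 1 : P ≅ B □_B P ⟶ A □_B P`, with components `i.t` and `1`. -/
noncomputable def boxOne : P.X ⟶ G.box pb P :=
  G.boxLift pb P (P.t ≫ G.i) (𝟙 _)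
    (by
      have h := IsAdmissible.post P.mem G.i (𝟙 _)
      rwa [Category.comp_id] at h)
    (by rw [Category.assoc, G.i_s, Category.id_comp, Category.comp_id])

/-- `A □_B P` as an object over `B` via `t.p₁`, with the section `i □ j`. -/
noncomputable abbrev boxOver : PointedOver S G.B where
  X := G.box pb P
  t := G.p₁ pb P ≫ G.t
  j := G.boxLift pb P G.i P.j
    (by
      have h := IsAdmissible.post G.mem_id G.i P.j
      rwa [Category.id_comp, Category.id_comp] at h)
    (by rw [G.i_s, P.j_t])
  j_t := by rw [← Category.assoc, boxLift_p₁, G.i_t]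
  mem := by
    refine (pb.isRelPullback G.s P.t G.mem_s P.mem).reflect_right _ _ ?_ ?_
    · have h := IsAdmissible.pre G.mem_t (G.p₁ pb P)
      rw [Category.comp_id] at h
      rw [Category.id_comp]
      exact h
    · have h := IsAdmissible.post (G.box_mem pb P) G.t (𝟙 _)
      rw [Category.comp_id] at h
      rw [Category.id_comp]
      exact h

/-- The relative power `A^{□ (n+1)}`: it is `A` for `n = 0`, and
`A^{□ (n+2)} = A □_B A^{□ (n+1)}`. -/
noncomputable def powSucc : ℕ → PointedOver S G.B
  | 0 => G.selfOver
  | n + 1 => G.boxOver pb (powSucc n)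

/-- The relative power `A^{□ n}`: it is `B` for `n = 0` and `A` for `n = 1`. The structure of
an object over `B` is `t.p₁` and the section is `i □ ⋯ □ i`. -/
noncomputable def pow : ℕ → PointedOver S G.B
  | 0 => G.unitOver
  | n + 1 => G.powSucc pb n

/-- `A □_B A`. -/
abbrev AA : D := G.box pb G.selfOver

/-- `A □_B (A □_B A)`. -/
noncomputable abbrev AAA : D := G.box pb (G.boxOver pb G.selfOver)

/-- The first two of the three factors, `A □_B (A □_B A) ⟶ A □_B A`. -/
noncomputable def p₁₂ : G.AAA pb ⟶ G.AA pb :=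
  G.boxLift pb G.selfOver (G.p₁ pb _) (G.p₂ pb _ ≫ G.p₁ pb _)
    (by
      have h := IsAdmissible.post (G.box_mem pb (G.boxOver pb G.selfOver)) (𝟙 _)
        (G.p₁ pb G.selfOver)
      rwa [Category.comp_id] at h)
    (by
      have h := G.box_w pb (G.boxOver pb G.selfOver)
      simpa only [Category.assoc] using h)

theorem p₁₂_p₁ : G.p₁₂ pb ≫ G.p₁ pb G.selfOver = G.p₁ pb (G.boxOver pb G.selfOver) := by
  rw [p₁₂, boxLift_p₁]

theorem p₁₂_p₂ : G.p₁₂ pb ≫ G.p₂ pb G.selfOver =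
    G.p₂ pb (G.boxOver pb G.selfOver) ≫ G.p₁ pb G.selfOver := by
  rw [p₁₂, boxLift_p₂]

/-- The last factor, `A □_B (A □_B A) ⟶ A`. -/
noncomputable def p₃ : G.AAA pb ⟶ G.A := G.p₂ pb (G.boxOver pb G.selfOver) ≫ G.p₂ pb G.selfOver

theorem mem_p₁₂_p₃ : S (G.p₁₂ pb) (G.p₃ pb) := by
  refine (pb.isRelPullback G.s G.t G.mem_s G.mem_t).reflect_left _ _ ?_ ?_
  · have h := IsAdmissible.post (G.box_mem pb (G.boxOver pb G.selfOver)) (𝟙 _)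
      (G.p₂ pb G.selfOver)
    rw [Category.comp_id, ← p₁₂_p₁] at h
    exact h
  · have h := IsAdmissible.pre (G.box_mem pb G.selfOver) (G.p₂ pb (G.boxOver pb G.selfOver))
    rw [← p₁₂_p₂] at h
    exact h

/-- `1 □ d : A □_B (A □_B A) ⟶ A □_B A` for a morphism `d : A □_B A ⟶ A` with `t.d = t.p₁`. -/
noncomputable def oneBoxComp (d : G.AA pb ⟶ G.A) (d_t : d ≫ G.t = G.p₁ pb _ ≫ G.t) :
    G.AAA pb ⟶ G.AA pb :=
  G.boxLift pb G.selfOver (G.p₁ pb _) (G.p₂ pb _ ≫ d)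
    (by
      have h := IsAdmissible.post (G.box_mem pb (G.boxOver pb G.selfOver)) (𝟙 _) d
      rwa [Category.comp_id] at h)
    (by
      have h := G.box_w pb (G.boxOver pb G.selfOver)
      rw [Category.assoc]
      exact h.trans (congrArg (fun z => G.p₂ pb (G.boxOver pb G.selfOver) ≫ z) d_t.symm))

/-- `d □ 1 : A □_B (A □_B A) ≅ (A □_B A) □_B A ⟶ A □_B A` for a morphism `d : A □_B A ⟶ A` with
`s.d = s.p₂`. -/
noncomputable def compBoxOne (d : G.AA pb ⟶ G.A) (d_s : d ≫ G.s = G.p₂ pb _ ≫ G.s) :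
    G.AAA pb ⟶ G.AA pb :=
  G.boxLift pb G.selfOver (G.p₁₂ pb ≫ d) (G.p₃ pb)
    (by
      have h := IsAdmissible.post (G.mem_p₁₂_p₃ pb) d (𝟙 _)
      rwa [Category.comp_id] at h)
    (by
      have h := G.box_w pb G.selfOver
      rw [Category.assoc, d_s, ← Category.assoc, p₁₂_p₂, p₃, Category.assoc, Category.assoc, h])

end ReflGraph

/-- An `S`-relative category: a monoid `(A, d, i)` in the monoidal category of those spans
`B ⟵t- A -s⟶ B` whose legs are in `S`, with the relative pullback `□_B` as monoidal product and
with the unit object `B = B = B`. -/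
structure RelCat [IsAdmissible S] (pb : ChosenRelPullbacks S) extends ReflGraph S where
  d : toReflGraph.AA pb ⟶ A
  d_s : d ≫ s = toReflGraph.p₂ pb _ ≫ s
  d_t : d ≫ t = toReflGraph.p₁ pb _ ≫ t
  unit_left : toReflGraph.boxOne pb toReflGraph.selfOver ≫ d = 𝟙 A
  unit_right : toReflGraph.oneBox pb toReflGraph.selfOver ≫ d = 𝟙 A
  assoc : toReflGraph.oneBoxComp pb d d_t ≫ d = toReflGraph.compBoxOne pb d d_s ≫ d

namespace RelCat

variable [IsAdmissible S] {pb : ChosenRelPullbacks S}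

/-- `a □ a : A □_B A ⟶ A₁ □_{B₁} A₁` for a pair of morphisms `b : B ⟶ B₁`, `a : A ⟶ A₁` that is
compatible with `s` and `t`. -/
noncomputable def mapAA (pb : ChosenRelPullbacks S) {G H : ReflGraph S} (b : G.B ⟶ H.B)
    (a : G.A ⟶ H.A) (hs : a ≫ H.s = G.s ≫ b) (ht : a ≫ H.t = G.t ≫ b) : G.AA pb ⟶ H.AA pb :=
  H.boxLift pb H.selfOver (G.p₁ pb _ ≫ a) (G.p₂ pb G.selfOver ≫ a)
    (IsAdmissible.post (G.box_mem pb G.selfOver) a a)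
    (by
      have h := G.box_w pb G.selfOver
      have ht₁ : a ≫ H.selfOver.t = G.selfOver.t ≫ b := ht
      rw [Category.assoc, Category.assoc, hs, ← Category.assoc, h, Category.assoc]
      exact congrArg (fun z => G.p₂ pb G.selfOver ≫ z) ht₁.symm)

/-- `S`-relative functors. -/
structure Hom (G H : RelCat pb) where
  b : G.B ⟶ H.B
  a : G.A ⟶ H.A
  comm_s : a ≫ H.s = G.s ≫ b
  comm_t : a ≫ H.t = G.t ≫ b
  comm_i : b ≫ H.i = G.i ≫ a
  comm_d : G.d ≫ a = mapAA pb b a comm_s comm_t ≫ H.d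

theorem Hom.ext_of {G H : RelCat pb} {F K : Hom G H} (hb : F.b = K.b) (ha : F.a = K.a) :
    F = K := by
  cases F; cases K; cases hb; cases ha; rfl

/-- The identity functor. -/
def Hom.id (G : RelCat pb) : Hom G G where
  b := 𝟙 _
  a := 𝟙 _
  comm_s := by rw [Category.id_comp, Category.comp_id]
  comm_t := by rw [Category.id_comp, Category.comp_id]
  comm_i := by rw [Category.id_comp, Category.comp_id]
  comm_d := by
    have e : mapAA pb (𝟙 G.B) (𝟙 G.A) (by rw [Category.id_comp, Category.comp_id])
        (by rw [Category.id_comp, Category.comp_id]) = 𝟙 _ := by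
      apply G.box_hom_ext pb
      · rw [mapAA, ReflGraph.boxLift_p₁, Category.comp_id, Category.id_comp]
      · rw [mapAA, ReflGraph.boxLift_p₂, Category.id_comp]
        exact Category.comp_id _
    rw [e, Category.id_comp, Category.comp_id]

/-- The composite functor. -/
def Hom.comp {G H K : RelCat pb} (F : Hom G H) (F₁ : Hom H K) : Hom G K where
  b := F.b ≫ F₁.b
  a := F.a ≫ F₁.a
  comm_s := by rw [Category.assoc, F₁.comm_s, ← Category.assoc, F.comm_s, Category.assoc]
  comm_t := by rw [Category.assoc, F₁.comm_t, ← Category.assoc, F.comm_t, Category.assoc]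
  comm_i := by rw [Category.assoc, F₁.comm_i, ← Category.assoc, F.comm_i, Category.assoc]
  comm_d := by
    rw [← Category.assoc, F.comm_d, Category.assoc, F₁.comm_d, ← Category.assoc]
    refine congrArg (fun z => z ≫ K.d) (K.box_hom_ext pb _ ?_ ?_)
    · rw [mapAA, mapAA, mapAA, Category.assoc, ReflGraph.boxLift_p₁, ReflGraph.boxLift_p₁,
        ← Category.assoc, ReflGraph.boxLift_p₁, Category.assoc]
    · rw [mapAA, mapAA, mapAA, Category.assoc, ReflGraph.boxLift_p₂, ReflGraph.boxLift_p₂,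
        ← Category.assoc, ReflGraph.boxLift_p₂, Category.assoc]

instance : Category (RelCat pb) where
  Hom := Hom
  id := Hom.id
  comp := Hom.comp
  id_comp _ := Hom.ext_of (Category.id_comp _) (Category.id_comp _)
  comp_id _ := Hom.ext_of (Category.comp_id _) (Category.comp_id _)
  assoc _ _ _ := Hom.ext_of (Category.assoc _ _ _) (Category.assoc _ _ _)

end RelCat

end RelativeCategories

/-! ## Monoidal classes of spans and the induced class of spans of monoids -/

section Monoids

variable {C : Type u} [Category.{v} C] [MonoidalCategory C]

/-- Monoidal classes of spans: `I = I = I` is in the class (unitality), and the class is closed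
under monoidal products of spans (multiplicativity). -/
class IsMonoidalClass (S : SpanClass C) : Prop where
  unital : S (𝟙 (𝟙_ C)) (𝟙 (𝟙_ C))
  multiplicative : ∀ {X A Y X₁ A₁ Y₁ : C} {f : A ⟶ X} {g : A ⟶ Y} {f₁ : A₁ ⟶ X₁}
    {g₁ : A₁ ⟶ Y₁}, S f g → S f₁ g₁ → S (f ⊗ₘ f₁) (g ⊗ₘ g₁)

/-- The induced class of spans in the category of monoids: those spans of monoid morphisms whose
underlying span is in `S`. -/
def monSpan (S : SpanClass C) : SpanClass (Mon C) := fun _ _ _ f g => S f.hom g.hom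

theorem left_leg {S : SpanClass C} {A B : Mon C} {f : A ⟶ B} (h : monSpan S (𝟙 A) f) :
    S (𝟙 A.X) f.hom := h

theorem right_leg {S : SpanClass C} {A B : Mon C} {f : A ⟶ B} (h : monSpan S f (𝟙 A)) :
    S f.hom (𝟙 A.X) := h

instance (S : SpanClass C) [IsAdmissible S] : IsAdmissible (monSpan S) where
  post h f g := IsAdmissible.post (S := S) h f.hom g.hom
  pre h k := IsAdmissible.pre (S := S) h k.hom

variable {S : SpanClass C} [IsAdmissible S] [IsMonoidalClass S]

theorem mem_of_unit {X Y : C} (f : 𝟙_ C ⟶ X) (g : 𝟙_ C ⟶ Y) : S f g := by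
  have h := IsAdmissible.post (IsMonoidalClass.unital (S := S)) f g
  rwa [Category.id_comp, Category.id_comp] at h

theorem mul_assoc_tensor {P : C} {A : C} [MonObj A] (p : P ⟶ A) :
    ((p ⊗ₘ p) ≫ μ[A] ⊗ₘ p) ≫ μ[A] = (α_ P P P).hom ≫ (p ⊗ₘ (p ⊗ₘ p) ≫ μ[A]) ≫ μ[A] := by
  have h₁ : ((p ⊗ₘ p) ≫ μ[A] ⊗ₘ p) = ((p ⊗ₘ p) ⊗ₘ p) ≫ μ[A] ▷ A := by
    rw [← tensorHom_id, MonoidalCategory.tensorHom_comp_tensorHom, Category.comp_id]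
  have h₂ : (p ⊗ₘ (p ⊗ₘ p) ≫ μ[A]) = (p ⊗ₘ (p ⊗ₘ p)) ≫ A ◁ μ[A] := by
    rw [← id_tensorHom, MonoidalCategory.tensorHom_comp_tensorHom, Category.comp_id]
  rw [h₁, h₂, Category.assoc, MonObj.mul_assoc, associator_naturality_assoc, Category.assoc]

namespace ChosenRelPullbacks

variable (pb : ChosenRelPullbacks S)

section

variable {A B E : Mon C} (f : A ⟶ B) (g : E ⟶ B) (hf : S (𝟙 A.X) f.hom) (hg : S g.hom (𝟙 E.X))

/-- The monoid structure on the relative pullback of a cospan of monoids, uniquely determined by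
the requirement that the projections are morphisms of monoids. -/
noncomputable instance monObj : MonObj (pb.obj f.hom g.hom hf hg) where
  one := pb.lift hf hg η[A.X] η[E.X] (mem_of_unit _ _)
    (by rw [IsMonHom.one_hom, IsMonHom.one_hom])
  mul := pb.lift hf hg
    ((pb.fst f.hom g.hom hf hg ⊗ₘ pb.fst f.hom g.hom hf hg) ≫ μ[A.X])
    ((pb.snd f.hom g.hom hf hg ⊗ₘ pb.snd f.hom g.hom hf hg) ≫ μ[E.X])
    (IsAdmissible.post (IsMonoidalClass.multiplicative (pb.isRelPullback _ _ hf hg).mem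
      (pb.isRelPullback _ _ hf hg).mem) _ _)
    (by
      rw [Category.assoc, Category.assoc, IsMonHom.mul_hom, IsMonHom.mul_hom,
        MonoidalCategory.tensorHom_comp_tensorHom_assoc,
        MonoidalCategory.tensorHom_comp_tensorHom_assoc, (pb.isRelPullback _ _ hf hg).w])
  one_mul := by
    apply pb.hom_ext hf hg
    · rw [Category.assoc, lift_fst, ← tensorHom_id,
        MonoidalCategory.tensorHom_comp_tensorHom_assoc, lift_fst, Category.id_comp,
        MonObj.one_mul_hom]
    · rw [Category.assoc, lift_snd, ← tensorHom_id,
        MonoidalCategory.tensorHom_comp_tensorHom_assoc, lift_snd, Category.id_comp,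
        MonObj.one_mul_hom]
  mul_one := by
    apply pb.hom_ext hf hg
    · rw [Category.assoc, lift_fst, ← id_tensorHom,
        MonoidalCategory.tensorHom_comp_tensorHom_assoc, lift_fst, Category.id_comp,
        MonObj.mul_one_hom]
    · rw [Category.assoc, lift_snd, ← id_tensorHom,
        MonoidalCategory.tensorHom_comp_tensorHom_assoc, lift_snd, Category.id_comp,
        MonObj.mul_one_hom]
  mul_assoc := by
    apply pb.hom_ext hf hg
    · simp only [Category.assoc, lift_fst]
      rw [← tensorHom_id, MonoidalCategory.tensorHom_comp_tensorHom_assoc, lift_fst,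
        ← id_tensorHom, MonoidalCategory.tensorHom_comp_tensorHom_assoc, lift_fst,
        Category.id_comp, mul_assoc_tensor]
    · simp only [Category.assoc, lift_snd]
      rw [← tensorHom_id, MonoidalCategory.tensorHom_comp_tensorHom_assoc, lift_snd,
        ← id_tensorHom, MonoidalCategory.tensorHom_comp_tensorHom_assoc, lift_snd,
        Category.id_comp, mul_assoc_tensor]

end

section

variable {A B E : Mon C} (f : A ⟶ B) (g : E ⟶ B) (hf : S (𝟙 A.X) f.hom) (hg : S g.hom (𝟙 E.X))

theorem one_fst : η[pb.obj f.hom g.hom hf hg] ≫ pb.fst f.hom g.hom hf hg = η[A.X] :=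
  pb.lift_fst hf hg _ _ _ _

theorem one_snd : η[pb.obj f.hom g.hom hf hg] ≫ pb.snd f.hom g.hom hf hg = η[E.X] :=
  pb.lift_snd hf hg _ _ _ _

theorem mul_fst : μ[pb.obj f.hom g.hom hf hg] ≫ pb.fst f.hom g.hom hf hg =
    (pb.fst f.hom g.hom hf hg ⊗ₘ pb.fst f.hom g.hom hf hg) ≫ μ[A.X] :=
  pb.lift_fst hf hg _ _ _ _

theorem mul_snd : μ[pb.obj f.hom g.hom hf hg] ≫ pb.snd f.hom g.hom hf hg =
    (pb.snd f.hom g.hom hf hg ⊗ₘ pb.snd f.hom g.hom hf hg) ≫ μ[E.X] :=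
  pb.lift_snd hf hg _ _ _ _

/-- The relative pullback of monoids. -/
noncomputable abbrev monBox : Mon C where
  X := pb.obj f.hom g.hom hf hg
  mon := pb.monObj f g hf hg

/-- The first projection as a morphism of monoids. -/
def monFst : pb.monBox f g hf hg ⟶ A where
  hom := pb.fst f.hom g.hom hf hg
  isMonHom_hom := ⟨pb.one_fst f g hf hg, pb.mul_fst f g hf hg⟩

/-- The second projection as a morphism of monoids. -/
def monSnd : pb.monBox f g hf hg ⟶ E where
  hom := pb.snd f.hom g.hom hf hg
  isMonHom_hom := ⟨pb.one_snd f g hf hg, pb.mul_snd f g hf hg⟩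

/-- The induced morphism into the relative pullback as a morphism of monoids. -/
noncomputable def monLift {X : Mon C} (a : X ⟶ A) (c : X ⟶ E) (hac : S a.hom c.hom)
    (w : a.hom ≫ f.hom = c.hom ≫ g.hom) : X ⟶ pb.monBox f g hf hg where
  hom := pb.lift hf hg a.hom c.hom hac w
  isMonHom_hom :=
    { one_hom := by
        apply pb.hom_ext hf hg
        · rw [Category.assoc, lift_fst, IsMonHom.one_hom, one_fst]
        · rw [Category.assoc, lift_snd, IsMonHom.one_hom, one_snd]
      mul_hom := by
        apply pb.hom_ext hf hg
        · rw [Category.assoc, lift_fst, IsMonHom.mul_hom, Category.assoc, mul_fst,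
            MonoidalCategory.tensorHom_comp_tensorHom_assoc, lift_fst]
        · rw [Category.assoc, lift_snd, IsMonHom.mul_hom, Category.assoc, mul_snd,
            MonoidalCategory.tensorHom_comp_tensorHom_assoc, lift_snd] }

theorem monBox_isRelPullback :
    IsRelPullback (monSpan S) f g (pb.monFst f g hf hg) (pb.monSnd f g hf hg) where
  mem := (pb.isRelPullback f.hom g.hom hf hg).mem
  w := Mon.Hom.ext (pb.isRelPullback f.hom g.hom hf hg).w
  existsUnique_lift a c hac w := by
    have w₁ : a.hom ≫ f.hom = c.hom ≫ g.hom := congrArg Mon.Hom.hom w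
    refine ⟨pb.monLift f g hf hg a c hac w₁,
      ⟨Mon.Hom.ext (pb.lift_fst hf hg _ _ hac w₁), Mon.Hom.ext (pb.lift_snd hf hg _ _ hac w₁)⟩, ?_⟩
    rintro k ⟨h₁, h₂⟩
    refine Mon.Hom.ext (pb.hom_ext hf hg ?_ ?_)
    · exact (congrArg Mon.Hom.hom h₁).trans (pb.lift_fst hf hg _ _ hac w₁).symm
    · exact (congrArg Mon.Hom.hom h₂).trans (pb.lift_snd hf hg _ _ hac w₁).symm
  reflect_left h k h₁ h₂ := (pb.isRelPullback f.hom g.hom hf hg).reflect_left h.hom k.hom h₁ h₂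
  reflect_right k h h₁ h₂ := (pb.isRelPullback f.hom g.hom hf hg).reflect_right k.hom h.hom h₁ h₂

end

/-- The choice of relative pullbacks of monoids that is induced by a choice of relative pullbacks
in the underlying category. -/
noncomputable def mon : ChosenRelPullbacks (monSpan S) where
  obj f g hf hg := pb.monBox f g (left_leg hf) (right_leg hg)
  fst f g hf hg := pb.monFst f g (left_leg hf) (right_leg hg)
  snd f g hf hg := pb.monSnd f g (left_leg hf) (right_leg hg)
  isRelPullback f g hf hg := pb.monBox_isRelPullback f g (left_leg hf) (right_leg hg)

end ChosenRelPullbacks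

/-! ## The canonical morphisms `q_n` and the category of relative categories of monoids -/

section Canonical

variable (pb : ChosenRelPullbacks S) (G : ReflGraph (monSpan S))

theorem mem_unit (B : Mon C) :
    monSpan S (default : Mon.trivial C ⟶ B) (𝟙 (Mon.trivial C)) :=
  mem_of_unit (S := S) (X := B.X) (Y := 𝟙_ C) η[B.X] (𝟙 (𝟙_ C))

/-- The relative pullback `A □_B I` of `s : A ⟶ B` and the unit `u : I ⟶ B`. -/
noncomputable def AI : Mon C :=
  pb.mon.obj G.s (default : Mon.trivial C ⟶ G.B) G.mem_s (mem_unit G.B)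

/-- The projection `p_A : A □_B I ⟶ A`. -/
noncomputable def pA : AI pb G ⟶ G.A :=
  pb.mon.fst G.s (default : Mon.trivial C ⟶ G.B) G.mem_s (mem_unit G.B)

/-- `q = q₁ : (A □_B I) B -(p_A i)⟶ A A -m⟶ A`. -/
noncomputable def qOne : (AI pb G).X ⊗ G.B.X ⟶ G.A.X :=
  ((pA pb G).hom ⊗ₘ G.i.hom) ≫ μ[G.A.X]

/-- `(A □_B I) P -(p_A 1)⟶ A P -((1 □ j)(i □ 1))⟶ (A □_B P) (A □_B P) -m⟶ A □_B P`. -/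
noncomputable def qBox (P : PointedOver (monSpan S) G.B) :
    (AI pb G).X ⊗ P.X.X ⟶ (G.boxOver pb.mon P).X.X :=
  ((pA pb G).hom ▷ P.X.X) ≫ ((G.oneBox pb.mon P).hom ⊗ₘ (G.boxOne pb.mon P).hom) ≫
    μ[(G.boxOver pb.mon P).X.X]

/-- `q_{n+1} : (A □_B I) A^{□ n} ⟶ A^{□ (n+1)}`. -/
noncomputable def q : ∀ n : ℕ,
    (AI pb G).X ⊗ (G.pow pb.mon n).X.X ⟶ (G.pow pb.mon (n + 1)).X.X
  | 0 => qOne pb G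
  | n + 1 => qBox pb G (G.powSucc pb.mon n)

/-- The morphisms `q_n` are invertible for all positive integers `n`. -/
def qInvertible : ObjectProperty (RelCat pb.mon) :=
  fun G => ∀ n : ℕ, IsIso (q pb G.toReflGraph n)

/-- The category of `S`-relative categories in the category of monoids for which all `q_n` are
invertible, with the `S`-relative functors as morphisms. -/
abbrev CatMon : Type (max u v) := (qInvertible pb).FullSubcategory

end Canonical

/-! ## Distributive laws -/

section DistributiveLaws

/-- A distributive law `x : B Y ⟶ Y B` between monoids. -/
structure IsDistributiveLaw {B Y : C} [MonObj B] [MonObj Y] (x : B ⊗ Y ⟶ Y ⊗ B) : Prop where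
  mul_left : μ[B] ▷ Y ≫ x =
    (α_ B B Y).hom ≫ B ◁ x ≫ (α_ B Y B).inv ≫ x ▷ B ≫ (α_ Y B B).hom ≫ Y ◁ μ[B]
  mul_right : B ◁ μ[Y] ≫ x =
    (α_ B Y Y).inv ≫ x ▷ Y ≫ (α_ Y B Y).hom ≫ Y ◁ x ≫ (α_ Y Y B).inv ≫ μ[Y] ▷ B
  one_left : η[B] ▷ Y ≫ x = (λ_ Y).hom ≫ (ρ_ Y).inv ≫ Y ◁ η[B]
  one_right : B ◁ η[Y] ≫ x = (ρ_ B).hom ≫ (λ_ B).inv ≫ η[Y] ▷ B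

/-- The unit `u u : I ⟶ Y B` of the monoid induced by a distributive law. -/
def wreathOne (Y B : C) [MonObj Y] [MonObj B] : 𝟙_ C ⟶ Y ⊗ B :=
  (λ_ (𝟙_ C)).inv ≫ (η[Y] ⊗ₘ η[B])

/-- The multiplication `Y B Y B -(1 x 1)⟶ Y Y B B -(m m)⟶ Y B` of the monoid induced by a
distributive law. -/
def wreathMul {B Y : C} [MonObj B] [MonObj Y] (x : B ⊗ Y ⟶ Y ⊗ B) :
    (Y ⊗ B) ⊗ (Y ⊗ B) ⟶ Y ⊗ B :=
  (α_ Y B (Y ⊗ B)).hom ≫ Y ◁ ((α_ B Y B).inv ≫ x ▷ B ≫ (α_ Y B B).hom) ≫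
    (α_ Y Y (B ⊗ B)).inv ≫ (μ[Y] ⊗ₘ μ[B])

variable {B Y : C} [MonObj B] [MonObj Y] {x : B ⊗ Y ⟶ Y ⊗ B}

theorem wreath_one_mul (h : IsDistributiveLaw x) :
   wreathOne Y B ▷ (Y ⊗ B) ≫ wreathMul x = (λ_ (Y ⊗ B)).hom := by
  have h1 := h.one_left
  calc _ = 𝟙 _ ⊗≫ η[Y] ▷ (𝟙_ C ⊗ Y ⊗ B) ⊗≫ Y ◁ (η[B] ▷ Y ≫ x) ▷ B ⊗≫ (μ[Y] ▷ (B ⊗ B)) ≫ Y ◁ μ[B] := by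
        simp only [wreathMul, wreathOne, MonoidalCategory.tensorHom_def]; monoidal
    _ = 𝟙 _ ⊗≫ ((η[Y] ▷ (Y ⊗ (𝟙_ C ⊗ B))) ≫ (Y ◁ (Y ◁ (η[B] ▷ B)))) ⊗≫ (μ[Y] ▷ (B ⊗ B)) ≫ Y ◁ μ[B] := by
        rw [h1]; monoidal
    _ = 𝟙 _ ⊗≫ ((𝟙_ C) ◁ (Y ◁ (η[B] ▷ B))) ⊗≫ ((η[Y] ▷ Y ≫ μ[Y]) ▷ (B ⊗ B)) ≫ Y ◁ μ[B] := by
        rw [← whisker_exchange]; monoidal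
    _ = 𝟙 _ ⊗≫ Y ◁ (η[B] ▷ B ≫ μ[B]) := by rw [MonObj.one_mul]; monoidal
    _ = _ := by rw [MonObj.one_mul]; monoidal

theorem wreath_mul_one (h : IsDistributiveLaw x) :
   (Y ⊗ B) ◁ wreathOne Y B ≫ wreathMul x = (ρ_ (Y ⊗ B)).hom := by
  have h1 := h.one_right
  calc _ = 𝟙 _ ⊗≫ (Y ⊗ B ⊗ 𝟙_ C) ◁ η[B] ⊗≫ Y ◁ (B ◁ η[Y] ≫ x) ▷ B ⊗≫ (Y ⊗ Y) ◁ μ[B] ≫ (μ[Y] ▷ B) := by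
        simp only [wreathMul, wreathOne, MonoidalCategory.tensorHom_def']; monoidal
    _ = 𝟙 _ ⊗≫ ((((Y ⊗ 𝟙_ C) ⊗ B) ◁ η[B]) ≫ ((Y ◁ η[Y]) ▷ B) ▷ B) ⊗≫ (Y ⊗ Y) ◁ μ[B] ≫ (μ[Y] ▷ B) := by
        rw [h1]; monoidal
    _ = 𝟙 _ ⊗≫ ((Y ◁ η[Y]) ▷ B) ⊗≫ (Y ⊗ Y) ◁ (B ◁ η[B] ≫ μ[B]) ≫ (μ[Y] ▷ B) := by
        rw [whisker_exchange]; monoidal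
    _ = 𝟙 _ ⊗≫ (Y ◁ η[Y] ≫ μ[Y]) ▷ B := by rw [MonObj.mul_one]; monoidal
    _ = _ := by rw [MonObj.mul_one]; monoidal

theorem wreath_mul_assoc (h : IsDistributiveLaw x) :
   (wreathMul x) ▷ (Y ⊗ B) ≫ wreathMul x = (α_ _ _ _).hom ≫ (Y ⊗ B) ◁ wreathMul x ≫ wreathMul x := by
  have h1 := h.mul_left
  have h2 := h.mul_right
  have h3 := MonObj.mul_assoc B
  have h4 := MonObj.mul_assoc Y
  calc _ = 𝟙 _ ⊗≫ Y ◁ x ▷ (B ⊗ Y ⊗ B) ⊗≫ ((μ[Y] ▷ (B ⊗ B) ≫ Y ◁ μ[B]) ▷ (Y ⊗ B)) ⊗≫ Y ◁ x ▷ B ⊗≫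
          (μ[Y] ▷ (B ⊗ B)) ≫ Y ◁ μ[B] := by
        simp only [wreathMul, MonoidalCategory.tensorHom_def]; monoidal
    _ = 𝟙 _ ⊗≫ Y ◁ x ▷ (B ⊗ Y ⊗ B) ⊗≫ μ[Y] ▷ ((B ⊗ B) ⊗ Y ⊗ B) ⊗≫ Y ◁ (μ[B] ▷ Y ≫ x) ▷ B ⊗≫
          (μ[Y] ▷ (B ⊗ B)) ≫ Y ◁ μ[B] := by monoidal
    _ = 𝟙 _ ⊗≫ Y ◁ x ▷ (B ⊗ Y ⊗ B) ⊗≫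
          (μ[Y] ▷ (B ⊗ (B ⊗ Y) ⊗ B) ≫ Y ◁ (B ◁ x ▷ B)) ⊗≫ Y ◁ x ▷ (B ⊗ B) ⊗≫
          ((Y ⊗ Y) ◁ (μ[B] ▷ B) ≫ (μ[Y] ▷ (B ⊗ B))) ⊗≫ Y ◁ μ[B] := by rw [h1]; monoidal
    _ = 𝟙 _ ⊗≫ Y ◁ x ▷ (B ⊗ Y ⊗ B) ⊗≫
          (Y ⊗ Y) ◁ (B ◁ x ▷ B) ⊗≫ (μ[Y] ▷ ((B ⊗ Y) ⊗ B ⊗ B) ≫ Y ◁ (x ▷ (B ⊗ B))) ⊗≫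
          (μ[Y] ▷ ((B ⊗ B) ⊗ B)) ⊗≫ Y ◁ (μ[B] ▷ B ≫ μ[B]) := by
        rw [← whisker_exchange, whisker_exchange (μ[Y]) (μ[B] ▷ B)]; monoidal
    _ = 𝟙 _ ⊗≫ Y ◁ x ▷ (B ⊗ Y ⊗ B) ⊗≫
          (Y ⊗ Y) ◁ (B ◁ x ▷ B) ⊗≫ (Y ⊗ Y) ◁ (x ▷ (B ⊗ B)) ⊗≫
          (μ[Y] ▷ Y ≫ μ[Y]) ▷ ((B ⊗ B) ⊗ B) ⊗≫ Y ◁ (μ[B] ▷ B ≫ μ[B]) := by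
        rw [← whisker_exchange]; monoidal
    _ = 𝟙 _ ⊗≫ (Y ◁ (x ▷ (B ⊗ Y) ≫ (Y ⊗ B) ◁ x) ▷ B) ⊗≫
          (Y ⊗ Y) ◁ (x ▷ (B ⊗ B)) ⊗≫
          (Y ◁ μ[Y] ≫ μ[Y]) ▷ (B ⊗ B ⊗ B) ⊗≫ Y ◁ (B ◁ μ[B] ≫ μ[B]) := by
        rw [h3, h4]; monoidal
    _ = 𝟙 _ ⊗≫ Y ◁ (B ⊗ Y) ◁ x ▷ B ⊗≫ Y ◁ x ▷ (Y ⊗ B ⊗ B) ⊗≫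
          (Y ⊗ Y) ◁ (x ▷ (B ⊗ B)) ⊗≫
          (Y ◁ μ[Y]) ▷ (B ⊗ B ⊗ B) ⊗≫ (μ[Y] ▷ (B ⊗ B ⊗ B) ≫ Y ◁ (B ◁ μ[B])) ⊗≫ Y ◁ μ[B] := by
        rw [← whisker_exchange]; monoidal
    _ = 𝟙 _ ⊗≫ Y ◁ (B ⊗ Y) ◁ x ▷ B ⊗≫ Y ◁ x ▷ (Y ⊗ B ⊗ B) ⊗≫
          (Y ⊗ Y) ◁ (x ▷ (B ⊗ B)) ⊗≫
          Y ◁ (μ[Y] ▷ (B ⊗ B ⊗ B)) ⊗≫ Y ◁ (Y ◁ (B ◁ μ[B])) ⊗≫ μ[Y] ▷ (B ⊗ B) ⊗≫ Y ◁ μ[B] := by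
        rw [← whisker_exchange]; monoidal
    _ = 𝟙 _ ⊗≫ Y ◁ (B ⊗ Y) ◁ x ▷ B ⊗≫ Y ◁ x ▷ (Y ⊗ B ⊗ B) ⊗≫
          (Y ⊗ Y) ◁ (x ▷ (B ⊗ B)) ⊗≫
          Y ◁ (μ[Y] ▷ (B ⊗ B ⊗ B) ≫ Y ◁ (B ◁ μ[B])) ⊗≫ μ[Y] ▷ (B ⊗ B) ⊗≫ Y ◁ μ[B] := by
        monoidal
    _ = 𝟙 _ ⊗≫ Y ◁ (B ⊗ Y) ◁ x ▷ B ⊗≫ Y ◁ x ▷ (Y ⊗ B ⊗ B) ⊗≫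
          (Y ⊗ Y) ◁ (x ▷ (B ⊗ B) ≫ (Y ⊗ B) ◁ μ[B]) ⊗≫
          Y ◁ (μ[Y] ▷ (B ⊗ B)) ⊗≫ μ[Y] ▷ (B ⊗ B) ⊗≫ Y ◁ μ[B] := by
        rw [← whisker_exchange]; monoidal
    _ = 𝟙 _ ⊗≫ Y ◁ (B ⊗ Y) ◁ x ▷ B ⊗≫ Y ◁ (x ▷ (Y ⊗ B ⊗ B) ≫ (Y ⊗ B) ◁ (Y ◁ μ[B])) ⊗≫
          (Y ⊗ Y) ◁ (x ▷ B) ⊗≫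
          Y ◁ (μ[Y] ▷ (B ⊗ B)) ⊗≫ μ[Y] ▷ (B ⊗ B) ⊗≫ Y ◁ μ[B] := by
        rw [← whisker_exchange]; monoidal
    _ = 𝟙 _ ⊗≫ Y ◁ (B ⊗ Y) ◁ x ▷ B ⊗≫ Y ◁ (B ⊗ Y) ◁ (Y ◁ μ[B]) ⊗≫
          Y ◁ ((α_ B Y Y).inv ≫ x ▷ Y ≫ (α_ Y B Y).hom ≫ Y ◁ x ≫ (α_ Y Y B).inv ≫ μ[Y] ▷ B) ▷ B ⊗≫
          μ[Y] ▷ (B ⊗ B) ⊗≫ Y ◁ μ[B] := by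
        rw [← whisker_exchange]; monoidal
    _ = 𝟙 _ ⊗≫ Y ◁ (B ⊗ Y) ◁ x ▷ B ⊗≫ Y ◁ B ◁ ((Y ⊗ Y) ◁ μ[B] ≫ μ[Y] ▷ B) ⊗≫
          Y ◁ x ▷ B ⊗≫
          μ[Y] ▷ (B ⊗ B) ⊗≫ Y ◁ μ[B] := by
        rw [← h2]; monoidal
    _ = _ := by
        simp only [wreathMul, MonoidalCategory.tensorHom_def]; rw [whisker_exchange]; monoidal

theorem wreathMul_counit (e : Y ⟶ 𝟙_ C) [IsMonHom e]
    (hx : x ≫ e ▷ B ≫ (λ_ B).hom = B ◁ e ≫ (ρ_ B).hom) :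
    wreathMul x ≫ e ▷ B ≫ (λ_ B).hom = ((e ▷ B ≫ (λ_ B).hom) ⊗ₘ (e ▷ B ≫ (λ_ B).hom)) ≫ μ[B] := by
  have he : μ[Y] ≫ e = Y ◁ e ≫ (ρ_ Y).hom ≫ e := by
    rw [IsMonHom.mul_hom, MonoidalCategory.tensorHom_def']; simp [unitors_equal]
  calc _ = 𝟙 _ ⊗≫ Y ◁ x ▷ B ⊗≫ ((Y ⊗ Y) ◁ μ[B] ≫ (μ[Y] ▷ B)) ⊗≫ e ▷ B ⊗≫ 𝟙 _ := by
        simp only [wreathMul, MonoidalCategory.tensorHom_def']; monoidal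
    _ = 𝟙 _ ⊗≫ Y ◁ x ▷ B ⊗≫ (μ[Y] ≫ e) ▷ (B ⊗ B) ⊗≫ μ[B] := by
        rw [whisker_exchange]
        have := whisker_exchange e (μ[B])
        calc _ = 𝟙 _ ⊗≫ Y ◁ x ▷ B ⊗≫ (μ[Y] ▷ (B ⊗ B)) ≫ (Y ◁ μ[B] ≫ e ▷ B) ⊗≫ 𝟙 _ := by monoidal
          _ = _ := by rw [this]; monoidal
    _ = 𝟙 _ ⊗≫ Y ◁ (x ≫ e ▷ B ≫ (λ_ B).hom) ▷ B ⊗≫ e ▷ (B ⊗ B) ⊗≫ μ[B] := by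
        rw [he]; monoidal
    _ = 𝟙 _ ⊗≫ (Y ◁ (B ◁ e ▷ B) ≫ e ▷ _) ⊗≫ μ[B] := by
        rw [hx]; monoidal
    _ = _ := by rw [whisker_exchange, MonoidalCategory.tensorHom_def]; monoidal

theorem wreathMul_action (k : Y ⟶ B) [IsMonHom k]
    (hx : x ≫ k ▷ B ≫ μ[B] = B ◁ k ≫ μ[B]) :
    wreathMul x ≫ k ▷ B ≫ μ[B] = ((k ▷ B ≫ μ[B]) ⊗ₘ (k ▷ B ≫ μ[B])) ≫ μ[B] := by
  have he : μ[Y] ≫ k = Y ◁ k ≫ k ▷ B ≫ μ[B] := by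
    rw [IsMonHom.mul_hom, MonoidalCategory.tensorHom_def']; simp
  have h3 := MonObj.mul_assoc B
  have h5 := MonObj.mul_assoc_flip B
  have ex := whisker_exchange k (μ[B])
  calc _ = 𝟙 _ ⊗≫ Y ◁ x ▷ B ⊗≫ ((Y ⊗ Y) ◁ μ[B] ≫ (μ[Y] ▷ B)) ⊗≫ k ▷ B ⊗≫ μ[B] := by
        simp only [wreathMul, MonoidalCategory.tensorHom_def']; monoidal
    _ = 𝟙 _ ⊗≫ Y ◁ x ▷ B ⊗≫ (μ[Y] ▷ (B ⊗ B)) ≫ (Y ◁ μ[B] ≫ k ▷ B) ⊗≫ μ[B] := by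
        rw [whisker_exchange]; monoidal
    _ = 𝟙 _ ⊗≫ Y ◁ x ▷ B ⊗≫ (μ[Y] ≫ k) ▷ (B ⊗ B) ⊗≫ (B ◁ μ[B] ≫ μ[B]) := by
        rw [ex]; monoidal
    _ = 𝟙 _ ⊗≫ Y ◁ (x ≫ k ▷ B) ▷ B ⊗≫ k ▷ (B ⊗ B ⊗ B) ⊗≫ (μ[B] ▷ B ≫ μ[B]) ▷ B ⊗≫ μ[B] := by
        rw [he, h5]; monoidal
    _ = 𝟙 _ ⊗≫ Y ◁ (x ≫ k ▷ B) ▷ B ⊗≫ (k ▷ (B ⊗ B) ≫ B ◁ μ[B]) ▷ B ⊗≫ μ[B] ▷ B ⊗≫ μ[B] := by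
        rw [h3]; monoidal
    _ = 𝟙 _ ⊗≫ Y ◁ (x ≫ k ▷ B ≫ μ[B]) ▷ B ⊗≫ k ▷ (B ⊗ B) ⊗≫ μ[B] ▷ B ⊗≫ μ[B] := by
        rw [← whisker_exchange]; monoidal
    _ = 𝟙 _ ⊗≫ Y ◁ (B ◁ k) ▷ B ⊗≫ (Y ◁ μ[B] ≫ k ▷ B) ▷ B ⊗≫ (μ[B] ▷ B ≫ μ[B]) := by
        rw [hx]; monoidal
    _ = 𝟙 _ ⊗≫ (Y ◁ (B ◁ k ▷ B) ≫ k ▷ _) ⊗≫ (B ◁ μ[B] ≫ μ[B]) ▷ B ⊗≫ μ[B] := by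
        rw [ex]; monoidal
    _ = 𝟙 _ ⊗≫ (Y ◁ (B ◁ k ▷ B) ≫ k ▷ _) ⊗≫ μ[B] ▷ (B ⊗ B) ⊗≫ (μ[B] ▷ B ≫ μ[B]) := by
        rw [h5]; monoidal
    _ = 𝟙 _ ⊗≫ (k ▷ _ ≫ B ◁ (B ◁ k ▷ B)) ⊗≫ (μ[B] ▷ (B ⊗ B) ≫ B ◁ μ[B]) ⊗≫ μ[B] := by
        rw [h3, whisker_exchange]; monoidal
    _ = 𝟙 _ ⊗≫ k ▷ (B ⊗ Y ⊗ B) ⊗≫ ((B ⊗ B) ◁ (k ▷ B) ≫ (B ⊗ B) ◁ μ[B] ≫ μ[B] ▷ B) ⊗≫ μ[B] := by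
        rw [whisker_exchange]; monoidal
    _ = 𝟙 _ ⊗≫ k ▷ (B ⊗ Y ⊗ B) ⊗≫ (μ[B] ▷ (Y ⊗ B) ≫ B ◁ (k ▷ B ≫ μ[B])) ⊗≫ μ[B] := by
        rw [← whisker_exchange]; monoidal
    _ = _ := by rw [MonoidalCategory.tensorHom_def]; monoidal

end DistributiveLaws

/-! ## Crossed modules -/

section CrossedModules

/-- The data `(B, Y, e, k, x)` underlying a crossed module: monoids `B` and `Y`, monoid morphisms
`e : Y ⟶ I` and `k : Y ⟶ B` and a distributive law `x : B Y ⟶ Y B`, such that the spans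
`B ⟵k- Y = Y`, `Y = Y -e⟶ I` and `B = B = B` are in `S` and such that `e1.x = 1e` and
`m.k1.x = m.1k`. -/
structure CrossedData (S : SpanClass C) where
  B : Mon C
  Y : Mon C
  e : Y.X ⟶ 𝟙_ C
  e_isMonHom : IsMonHom e
  k : Y.X ⟶ B.X
  k_isMonHom : IsMonHom k
  x : B.X ⊗ Y.X ⟶ Y.X ⊗ B.X
  distributive : IsDistributiveLaw x
  mem_k : S k (𝟙 Y.X)
  mem_e : S (𝟙 Y.X) e
  mem_B : S (𝟙 B.X) (𝟙 B.X)
  x_e : x ≫ e ▷ B.X ≫ (λ_ B.X).hom = B.X ◁ e ≫ (ρ_ B.X).hom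
  x_k : x ≫ k ▷ B.X ≫ μ[B.X] = B.X ◁ k ≫ μ[B.X]

namespace CrossedData

/-- Morphisms are pairs of monoid morphisms `(b, y)` that are compatible with `e`, `k`, `x`. -/
structure Hom (M N : CrossedData S) where
  b : M.B ⟶ N.B
  y : M.Y ⟶ N.Y
  comm_e : y.hom ≫ N.e = M.e
  comm_k : y.hom ≫ N.k = M.k ≫ b.hom
  comm_x : (b.hom ⊗ₘ y.hom) ≫ N.x = M.x ≫ (y.hom ⊗ₘ b.hom)

theorem Hom.ext_of {M N : CrossedData S} {F K : Hom M N} (hb : F.b = K.b) (hy : F.y = K.y) :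
    F = K := by
  cases F; cases K; cases hb; cases hy; rfl

/-- The identity morphism. -/
def Hom.id (M : CrossedData S) : Hom M M where
  b := 𝟙 _
  y := 𝟙 _
  comm_e := Category.id_comp _
  comm_k := (Category.id_comp _).trans (Category.comp_id _).symm
  comm_x := by simp

/-- The composite morphism. -/
def Hom.comp {M N K : CrossedData S} (F : Hom M N) (F₁ : Hom N K) : Hom M K where
  b := F.b ≫ F₁.b
  y := F.y ≫ F₁.y
  comm_e := by rw [Mon.comp_hom', Category.assoc, F₁.comm_e, F.comm_e]
  comm_k := by
    rw [Mon.comp_hom', Mon.comp_hom', Category.assoc, F₁.comm_k, ← Category.assoc, F.comm_k,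
      Category.assoc]
  comm_x := by
    rw [Mon.comp_hom', Mon.comp_hom', ← MonoidalCategory.tensorHom_comp_tensorHom,
      Category.assoc, F₁.comm_x, ← Category.assoc, F.comm_x, Category.assoc,
      MonoidalCategory.tensorHom_comp_tensorHom]

instance : Category (CrossedData S) where
  Hom := Hom
  id := Hom.id
  comp := Hom.comp
  id_comp _ := Hom.ext_of (Category.id_comp _) (Category.id_comp _)
  comp_id _ := Hom.ext_of (Category.comp_id _) (Category.comp_id _)
  assoc _ _ _ := Hom.ext_of (Category.assoc _ _ _) (Category.assoc _ _ _)

variable (M : CrossedData S)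

/-- The morphism `e 1 : Y Z ⟶ Z`. -/
def eOne (Z : C) : M.Y.X ⊗ Z ⟶ Z := M.e ▷ Z ≫ (λ_ Z).hom

/-- The iterated product `Y ⋯ Y B` with `n` factors `Y`. -/
def YnB : ℕ → C
  | 0 => M.B.X
  | n + 1 => M.Y.X ⊗ YnB n

/-- The composite `Y ⋯ Y B -(k ⋯ k 1)⟶ B ⋯ B B -m⟶ B` with the iterated multiplication. -/
def kMul : ∀ n : ℕ, M.YnB n ⟶ M.B.X
  | 0 => 𝟙 M.B.X
  | n + 1 => (M.k ⊗ₘ kMul n) ≫ μ[M.B.X]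

theorem mem_eOne : S (𝟙 (M.Y.X ⊗ M.B.X)) (M.eOne M.B.X) := by
  have h := IsAdmissible.post (IsMonoidalClass.multiplicative M.mem_e M.mem_B)
    (𝟙 (M.Y.X ⊗ M.B.X)) (λ_ M.B.X).hom
  rwa [id_tensorHom_id, Category.comp_id, tensorHom_id] at h

theorem mem_kMul : ∀ n : ℕ, S (M.kMul n) (𝟙 (M.YnB n))
  | 0 => M.mem_B
  | n + 1 => by
    have h := IsAdmissible.post (IsMonoidalClass.multiplicative M.mem_k (mem_kMul n))
      μ[M.B.X] (𝟙 (M.Y.X ⊗ M.YnB n))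
    rwa [id_tensorHom_id, Category.comp_id] at h

variable (pb : ChosenRelPullbacks S)

/-- The morphism `f : Y ⟶ (Y B) □_B I` to the relative pullback of `e 1 : Y B ⟶ B` and
`u : I ⟶ B`, with components `1 u` and `e`. -/
noncomputable def f :
    M.Y.X ⟶ pb.obj (M.eOne M.B.X) η[M.B.X] M.mem_eOne (mem_of_unit _ _) :=
  pb.lift M.mem_eOne (mem_of_unit _ _) ((ρ_ M.Y.X).inv ≫ M.Y.X ◁ η[M.B.X]) M.e
    (by
      have h := IsAdmissible.post M.mem_e ((ρ_ M.Y.X).inv ≫ M.Y.X ◁ η[M.B.X]) (𝟙 _)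
      rwa [Category.id_comp, Category.comp_id] at h)
    (by
      rw [eOne, Category.assoc, whisker_exchange_assoc, leftUnitor_naturality,
        ← Category.assoc, ← Category.assoc]
      congr 1
      simp [unitors_equal])

/-- The morphism `b_{n+1} : Y Y^n B ⟶ (Y B) □_B (Y^n B)` to the relative pullback of
`e 1 : Y B ⟶ B` and `Y^n B -(k ⋯ k 1)⟶ B^{n+1} -m⟶ B`, with components `1 (m.(k ⋯ k 1))` and
`e 1 ⋯ 1`. -/
noncomputable def b (n : ℕ) :
    M.Y.X ⊗ M.YnB n ⟶ pb.obj (M.eOne M.B.X) (M.kMul n) M.mem_eOne (M.mem_kMul n) :=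
  pb.lift M.mem_eOne (M.mem_kMul n) (M.Y.X ◁ M.kMul n) (M.eOne (M.YnB n))
    (by
      have h := IsAdmissible.post (IsMonoidalClass.multiplicative M.mem_e (M.mem_kMul n))
        (𝟙 (M.Y.X ⊗ M.B.X)) (λ_ (M.YnB n)).hom
      rwa [Category.comp_id, id_tensorHom, tensorHom_id] at h)
    (by rw [eOne, eOne, whisker_exchange_assoc, leftUnitor_naturality, Category.assoc])

/-- The monoid `Y B` induced by the distributive law `x`. -/
def YB : Mon C where
  X := M.Y.X ⊗ M.B.X
  mon :=
    { one := wreathOne M.Y.X M.B.X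
      mul := wreathMul M.x
      one_mul := wreath_one_mul M.distributive
      mul_one := wreath_mul_one M.distributive
      mul_assoc := wreath_mul_assoc M.distributive }

/-- `e 1 : Y B ⟶ B` as a morphism of monoids. -/
def eB : M.YB ⟶ M.B where
  hom := M.eOne M.B.X
  isMonHom_hom :=
    { one_hom := by
        have := M.e_isMonHom
        have h : η[M.Y.X] ≫ M.e = 𝟙 _ := IsMonHom.one_hom M.e
        change wreathOne M.Y.X M.B.X ≫ M.e ▷ M.B.X ≫ (λ_ M.B.X).hom = η[M.B.X]
        rw [wreathOne, Category.assoc, MonoidalCategory.tensorHom_def_assoc, whisker_exchange_assoc,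
          ← comp_whiskerRight_assoc, h]
        simp
      mul_hom := by
        have := M.e_isMonHom
        exact wreathMul_counit M.e M.x_e }

/-- `Y B -(k 1)⟶ B B -m⟶ B` as a morphism of monoids. -/
def kB : M.YB ⟶ M.B where
  hom := M.kMul 1
  isMonHom_hom :=
    { one_hom := by
        have := M.k_isMonHom
        have h : η[M.Y.X] ≫ M.k = η[M.B.X] := IsMonHom.one_hom M.k
        change wreathOne M.Y.X M.B.X ≫ (M.k ⊗ₘ 𝟙 M.B.X) ≫ μ[M.B.X] = η[M.B.X]
        rw [wreathOne, Category.assoc, MonoidalCategory.tensorHom_comp_tensorHom_assoc, h,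
          Category.comp_id, MonObj.one_mul_hom]
        simp
      mul_hom := by
        have := M.k_isMonHom
        change wreathMul M.x ≫ (M.k ⊗ₘ 𝟙 M.B.X) ≫ μ[M.B.X] =
          (((M.k ⊗ₘ 𝟙 M.B.X) ≫ μ[M.B.X]) ⊗ₘ ((M.k ⊗ₘ 𝟙 M.B.X) ≫ μ[M.B.X])) ≫ μ[M.B.X]
        rw [tensorHom_id]
        exact wreathMul_action M.k M.x_k }

/-- The monoid `(Y B) □_B (Y B)`, relative pullback of the monoid morphisms `e 1` and
`m.(k 1)`. -/
noncomputable def YBYB : Mon C := pb.mon.obj M.eB M.kB M.mem_eOne (M.mem_kMul 1)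

/-- The morphism `b₂ : Y Y B ⟶ (Y B) □_B (Y B)`. -/
noncomputable def b₂ : M.Y.X ⊗ (M.Y.X ⊗ M.B.X) ⟶ (M.YBYB pb).X := M.b pb 1

/-- The morphism `m 1 : Y Y B ⟶ Y B`. -/
def mOne : M.Y.X ⊗ (M.Y.X ⊗ M.B.X) ⟶ M.Y.X ⊗ M.B.X :=
  (α_ M.Y.X M.Y.X M.B.X).inv ≫ μ[M.Y.X] ▷ M.B.X

/-- The morphism `u 1 1 : Y B ⟶ Y Y B`. -/
def uOneOne : M.Y.X ⊗ M.B.X ⟶ M.Y.X ⊗ (M.Y.X ⊗ M.B.X) :=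
  (λ_ (M.Y.X ⊗ M.B.X)).inv ≫ η[M.Y.X] ▷ (M.Y.X ⊗ M.B.X)

/-- The morphism `1 u u : Y ⟶ Y Y B`. -/
def oneUU : M.Y.X ⟶ M.Y.X ⊗ (M.Y.X ⊗ M.B.X) :=
  (ρ_ M.Y.X).inv ≫ M.Y.X ◁ wreathOne M.Y.X M.B.X

/-- The Peiffer condition, for invertible `b₂`: the composite
`Y B Y -(u 1 1 1 u u)⟶ (Y Y B)² -(b₂ b₂)⟶ ((Y B) □_B (Y B))² -m⟶ (Y B) □_B (Y B) -b₂⁻¹⟶ Y Y B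
-(m 1)⟶ Y B` is equal to `Y B Y -(1 x)⟶ Y Y B -(m 1)⟶ Y B`. -/
def Peiffer [IsIso (M.b₂ pb)] : Prop :=
  (M.uOneOne ⊗ₘ M.oneUU) ≫ (M.b₂ pb ⊗ₘ M.b₂ pb) ≫ μ[(M.YBYB pb).X] ≫ inv (M.b₂ pb) ≫ M.mOne =
    (α_ M.Y.X M.B.X M.Y.X).hom ≫ M.Y.X ◁ M.x ≫ M.mOne

end CrossedData

/-- The remaining conditions on a crossed module: the morphism `f` and the morphisms `b_n` for
all positive integers `n` are invertible, and the Peiffer condition holds. -/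
structure IsCrossedModule (pb : ChosenRelPullbacks S) (M : CrossedData S) : Prop where
  f_isIso : IsIso (M.f pb)
  b_isIso : ∀ n : ℕ, IsIso (M.b pb n)
  peiffer : haveI : IsIso (M.b₂ pb) := b_isIso 1
    M.Peiffer pb

/-- `IsCrossedModule` as a property of objects. -/
def crossedModuleProperty (pb : ChosenRelPullbacks S) : ObjectProperty (CrossedData S) :=
  fun M => IsCrossedModule pb M

/-- The category of `S`-relative crossed modules of monoids. -/
abbrev Xmod (pb : ChosenRelPullbacks S) : Type (max u v) :=
  (crossedModuleProperty pb).FullSubcategory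

end CrossedModules

end Monoids

end RelXmod

/-!
The functor `xmodToCatMon` from crossed modules to relative categories is an equivalence.

In a relative category in monoids, invertibility of `q₁ = m.(p_A i)` says that the monoid `A`
factorizes into the monoids `Y = A □_B I` (the relative kernel of `s`, via `p_A`) and `B` (via `i`).
A factorization `Y B ≅ A` of a monoid amounts to a distributive law `x : B Y ⟶ Y B`, obtained by
multiplying the factors in the opposite order (`isDistributiveLaw_of_extMul`), and morphisms out of
`A` are given by compatible morphisms out of `Y` and `B` (`CrossedData.desc`). So the reflexive graph
`A ⇉ B` is recovered from `x`, the projection `e : Y ⟶ I` and the restriction `k` of `t` to `Y`.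

The composition is no further datum. Along `b₂ : Y (Y B) ⟶ Y B □_B Y B` the monoid of composable
pairs factorizes into the monoids `Y` and `Y B` (`CrossedData.bYB_eq`), and the unit laws fix
the composition on both of them. Since it is multiplicative, it has to be `m 1.b₂⁻¹`. Conversely, this
morphism is multiplicative if and only if it has the expected values on the products in the order
opposite to that in `b₂`, and this is the Peiffer condition (`isMonHom_of_factorization`,
`CrossedData.peiffer_iff`, `CrossedData.comp`). Its associativity is the associativity of the action
of `Y` on `Y B` (`CrossedData.comp_assoc`), and every morphism of reflexive graphs out of the relative
category of a crossed module preserves the composition (`CrossedData.relFunctor`).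

The higher invertibility conditions match because of the square `Comparison.bOver_boxMap`: the
isomorphisms `Y^n B ≅ A^{□ n}` obtained by iterating the `q_n` carry `b_n` to `q_n`, up to
isomorphisms induced between relative pullbacks. An induction on `n` gives `Comparison.isIso_b_of_q`
and `Comparison.isIso_q_of_b`.

Hence `xmodToCatMon` is well defined. It is faithful and full because `Y B` is generated by `Y` and
`B`, and because invertibility of `f` makes `Y` the relative pullback of `Y B` along the unit of `B`.
It is essentially surjective because of the isomorphism `RelCat.counit` with components `1` and `q₁`.
-/

namespace RelXmod

/-! ### Products of generalized elements of a monoid -/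

section ExternalProduct

variable {C : Type u} [Category.{v} C] [MonoidalCategory C]

/-- The product `m.(f g) : X Y ⟶ A` of two generalized elements `f : X ⟶ A`, `g : Y ⟶ A` of a
monoid `A`. -/
def extMul {X Y A : C} [MonObj A] (f : X ⟶ A) (g : Y ⟶ A) : X ⊗ Y ⟶ A := (f ⊗ₘ g) ≫ μ[A]

local infixl:75 " ⋆ " => extMul

variable {X Y Z X₁ Y₁ A B : C} [MonObj A] [MonObj B]

theorem tensorHom_extMul (a : X₁ ⟶ X) (b : Y₁ ⟶ Y) (f : X ⟶ A) (g : Y ⟶ A) :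
    (a ⊗ₘ b) ≫ (f ⋆ g) = (a ≫ f) ⋆ (b ≫ g) := by
  rw [extMul, MonoidalCategory.tensorHom_comp_tensorHom_assoc, extMul]

theorem whiskerLeft_extMul (b : Y₁ ⟶ Y) (f : X ⟶ A) (g : Y ⟶ A) :
    X ◁ b ≫ (f ⋆ g) = f ⋆ (b ≫ g) := by
  rw [← id_tensorHom, tensorHom_extMul, Category.id_comp]

theorem whiskerRight_extMul (a : X₁ ⟶ X) (f : X ⟶ A) (g : Y ⟶ A) :
    a ▷ Y ≫ (f ⋆ g) = (a ≫ f) ⋆ g := by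
  rw [← tensorHom_id, tensorHom_extMul, Category.id_comp]

theorem extMul_comp (f : X ⟶ A) (g : Y ⟶ A) (h : A ⟶ B) [IsMonHom h] :
    (f ⋆ g) ≫ h = (f ≫ h) ⋆ (g ≫ h) := by
  rw [extMul, Category.assoc, IsMonHom.mul_hom, MonoidalCategory.tensorHom_comp_tensorHom_assoc,
    extMul]

theorem extMul_comp_hom {A B : Mon C} (f : X ⟶ A.X) (g : Y ⟶ A.X) (h : A ⟶ B) :
    (f ⋆ g) ≫ h.hom = (f ≫ h.hom) ⋆ (g ≫ h.hom) :=
  extMul_comp f g h.hom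

theorem mul_comp (h : A ⟶ B) [IsMonHom h] : μ[A] ≫ h = h ⋆ h := IsMonHom.mul_hom h

theorem extMul_assoc (f : X ⟶ A) (g : Y ⟶ A) (h : Z ⟶ A) :
    (α_ X Y Z).hom ≫ (f ⋆ (g ⋆ h)) = f ⋆ g ⋆ h := by
  have h₁ : f ⋆ g ⋆ h = ((f ⊗ₘ g) ⊗ₘ h) ≫ μ[A] ▷ A ≫ μ[A] := by
    rw [← tensorHom_id, MonoidalCategory.tensorHom_comp_tensorHom_assoc, Category.comp_id]
    rfl
  have h₂ : f ⋆ (g ⋆ h) = (f ⊗ₘ (g ⊗ₘ h)) ≫ A ◁ μ[A] ≫ μ[A] := by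
    rw [← id_tensorHom, MonoidalCategory.tensorHom_comp_tensorHom_assoc, Category.comp_id]
    rfl
  rw [h₁, h₂, MonObj.mul_assoc, associator_naturality_assoc]

theorem extMul_assoc_inv (f : X ⟶ A) (g : Y ⟶ A) (h : Z ⟶ A) :
    (α_ X Y Z).inv ≫ (f ⋆ g ⋆ h) = f ⋆ (g ⋆ h) := by
  rw [← extMul_assoc, Iso.inv_hom_id_assoc]

theorem one_extMul (f : X ⟶ A) : η[A] ⋆ f = (λ_ X).hom ≫ f := by
  rw [extMul, MonObj.one_mul_hom]

theorem extMul_one (f : X ⟶ A) : f ⋆ η[A] = (ρ_ X).hom ≫ f := by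
  rw [extMul, MonObj.mul_one_hom]

theorem one_extMul_inv [MonObj Y] (g : Y ⟶ A) [IsMonHom g] (f : X ⟶ A) :
    ((λ_ X).inv ≫ η[Y] ▷ X) ≫ (g ⋆ f) = f := by
  rw [Category.assoc, whiskerRight_extMul, IsMonHom.one_hom, one_extMul, Iso.inv_hom_id_assoc]

theorem extMul_one_inv [MonObj Y] (f : X ⟶ A) (g : Y ⟶ A) [IsMonHom g] :
    ((ρ_ X).inv ≫ X ◁ η[Y]) ≫ (f ⋆ g) = f := by
  rw [Category.assoc, whiskerLeft_extMul, IsMonHom.one_hom, extMul_one, Iso.inv_hom_id_assoc]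

theorem wreathOne_extMul {Y B : C} [MonObj Y] [MonObj B] (p : Y ⟶ A) (j : B ⟶ A)
    [IsMonHom p] [IsMonHom j] : wreathOne Y B ≫ (p ⋆ j) = η[A] := by
  rw [wreathOne, Category.assoc, tensorHom_extMul, IsMonHom.one_hom, IsMonHom.one_hom,
    one_extMul, Iso.inv_hom_id_assoc]

/-- Morphisms of monoids `p : Y ⟶ A` and `j : B ⟶ A` that are compatible with `x : B Y ⟶ Y B`
induce a multiplicative morphism from `Y B`. -/
theorem wreathMul_extMul {Y B : C} [MonObj Y] [MonObj B] {x : B ⊗ Y ⟶ Y ⊗ B} (p : Y ⟶ A)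
    (j : B ⟶ A) [IsMonHom p] [IsMonHom j] (hx : x ≫ (p ⋆ j) = j ⋆ p) :
    wreathMul x ≫ (p ⋆ j) = p ⋆ j ⋆ (p ⋆ j) := by
  simp only [wreathMul, Category.assoc, tensorHom_extMul, mul_comp, extMul_assoc_inv,
    whiskerLeft_extMul, extMul_assoc, whiskerRight_extMul, hx]

/-- If `m.(p j) : Y B ⟶ A` is invertible, then the multiplication `B Y ⟶ A` in the opposite order
is turned into a distributive law. -/
theorem isDistributiveLaw_of_extMul {Y B : C} [MonObj Y] [MonObj B] {x : B ⊗ Y ⟶ Y ⊗ B}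
    (p : Y ⟶ A) (j : B ⟶ A) [IsMonHom p] [IsMonHom j] [Mono (p ⋆ j)]
    (hx : x ≫ (p ⋆ j) = j ⋆ p) : IsDistributiveLaw x where
  mul_left := by
    rw [← cancel_mono (p ⋆ j)]
    simp only [Category.assoc, hx, whiskerLeft_extMul, whiskerRight_extMul, mul_comp, extMul_assoc,
      extMul_assoc_inv]
  mul_right := by
    rw [← cancel_mono (p ⋆ j)]
    simp only [Category.assoc, hx, whiskerLeft_extMul, whiskerRight_extMul, mul_comp, extMul_assoc,
      extMul_assoc_inv]
  one_left := by
    rw [← cancel_mono (p ⋆ j)]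
    simp only [Category.assoc, hx, whiskerLeft_extMul, whiskerRight_extMul, IsMonHom.one_hom,
      one_extMul, extMul_one, Iso.inv_hom_id_assoc]
  one_right := by
    rw [← cancel_mono (p ⋆ j)]
    simp only [Category.assoc, hx, whiskerLeft_extMul, whiskerRight_extMul, IsMonHom.one_hom,
      one_extMul, extMul_one, Iso.inv_hom_id_assoc]

/-- Suppose that multiplication along morphisms of monoids `ν : Y ⟶ P` and `w : A ⟶ P` is an
isomorphism `Y A ≅ P`. A morphism `φ : P ⟶ A` that is given by multiplication on the products
`ν w` is a morphism of monoids as soon as it is also given by multiplication on the products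
`w ν`. -/
theorem isMonHom_of_factorization {P Y : C} [MonObj P] [MonObj Y] (ν : Y ⟶ P) (w : A ⟶ P)
    (l : Y ⟶ A) [IsMonHom ν] [IsMonHom w] [IsMonHom l] [IsIso (ν ⋆ w)] (φ : P ⟶ A)
    (h₁ : (ν ⋆ w) ≫ φ = l ⋆ 𝟙 A) (h₂ : (w ⋆ ν) ≫ φ = 𝟙 A ⋆ l) : IsMonHom φ := by
  -- Both `m.(ν w)` and `m.(l 1)` are multiplicative for the same product on `Y A`.
  have hz : ((w ⋆ ν) ≫ inv (ν ⋆ w)) ≫ (ν ⋆ w) = w ⋆ ν := by simp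
  have hz' : ((w ⋆ ν) ≫ inv (ν ⋆ w)) ≫ (l ⋆ 𝟙 A) = 𝟙 A ⋆ l := by
    rw [← h₁, ← Category.assoc, hz, h₂]
  have e₁ := wreathMul_extMul ν w hz
  have e₂ := wreathMul_extMul l (𝟙 A) hz'
  constructor
  · rw [← wreathOne_extMul ν w, Category.assoc, h₁, wreathOne_extMul]
  · rw [← cancel_epi ((ν ⋆ w) ⊗ₘ (ν ⋆ w)), ← Category.assoc]
    change (ν ⋆ w ⋆ (ν ⋆ w)) ≫ φ = ((ν ⋆ w) ⊗ₘ (ν ⋆ w)) ≫ (φ ⋆ φ)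
    rw [← e₁, Category.assoc, h₁, e₂, tensorHom_extMul, h₁]

end ExternalProduct

/-! ### The inclusions into the monoid of a distributive law -/

section Wreath

variable {C : Type u} [Category.{v} C] [MonoidalCategory C]

local infixl:75 " ⋆ " => extMul

variable {B Y : C} [MonObj B] [MonObj Y]

/-- The morphism `1 u : Y ⟶ Y B`. -/
def wreathInl (Y B : C) [MonObj B] : Y ⟶ Y ⊗ B := (ρ_ Y).inv ≫ Y ◁ η[B]

/-- The morphism `u 1 : B ⟶ Y B`. -/
def wreathInr (Y B : C) [MonObj Y] : B ⟶ Y ⊗ B := (λ_ B).inv ≫ η[Y] ▷ B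

variable {x : B ⊗ Y ⟶ Y ⊗ B}

theorem one_wreathInl : η[Y] ≫ wreathInl Y B = wreathOne Y B := by
  rw [wreathInl, wreathOne, rightUnitor_inv_naturality_assoc, MonoidalCategory.tensorHom_def,
    unitors_inv_equal]

theorem one_wreathInr : η[B] ≫ wreathInr Y B = wreathOne Y B := by
  rw [wreathInr, wreathOne, leftUnitor_inv_naturality_assoc, MonoidalCategory.tensorHom_def']

theorem wreathInl_whiskerRight_wreathMul (h : IsDistributiveLaw x) :
    wreathInl Y B ▷ (Y ⊗ B) ≫ wreathMul x = (α_ Y Y B).inv ≫ μ[Y] ▷ B := by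
  have h₁ := h.one_left
  calc _ = 𝟙 _ ⊗≫ Y ◁ (η[B] ▷ Y ≫ x) ▷ B ⊗≫ μ[Y] ▷ (B ⊗ B) ≫ Y ◁ μ[B] := by
        simp only [wreathMul, wreathInl, MonoidalCategory.tensorHom_def]; monoidal
    _ = 𝟙 _ ⊗≫ ((Y ⊗ Y) ◁ (η[B] ▷ B) ≫ μ[Y] ▷ (B ⊗ B)) ≫ Y ◁ μ[B] := by rw [h₁]; monoidal
    _ = 𝟙 _ ⊗≫ μ[Y] ▷ (𝟙_ C ⊗ B) ⊗≫ Y ◁ (η[B] ▷ B ≫ μ[B]) := by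
        rw [whisker_exchange]; monoidal
    _ = _ := by rw [MonObj.one_mul]; monoidal

theorem wreathInr_whiskerLeft_wreathMul (h : IsDistributiveLaw x) :
    (Y ⊗ B) ◁ wreathInr Y B ≫ wreathMul x = (α_ Y B B).hom ≫ Y ◁ μ[B] := by
  have h₁ := h.one_right
  calc _ = 𝟙 _ ⊗≫ Y ◁ (B ◁ η[Y] ≫ x) ▷ B ⊗≫ (Y ⊗ Y) ◁ μ[B] ≫ μ[Y] ▷ B := by
        simp only [wreathMul, wreathInr, MonoidalCategory.tensorHom_def']; monoidal
    _ = 𝟙 _ ⊗≫ ((Y ◁ η[Y]) ▷ (B ⊗ B) ≫ (Y ⊗ Y) ◁ μ[B]) ≫ μ[Y] ▷ B := by rw [h₁]; monoidal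
    _ = 𝟙 _ ⊗≫ (Y ⊗ 𝟙_ C) ◁ μ[B] ⊗≫ (Y ◁ η[Y] ≫ μ[Y]) ▷ B := by
        rw [← whisker_exchange]; monoidal
    _ = _ := by rw [MonObj.mul_one]; monoidal

theorem wreathInl_tensor_wreathMul (h : IsDistributiveLaw x) {Z : C} (f : Z ⟶ Y ⊗ B) :
    (wreathInl Y B ⊗ₘ f) ≫ wreathMul x = Y ◁ f ≫ (α_ Y Y B).inv ≫ μ[Y] ▷ B := by
  rw [MonoidalCategory.tensorHom_def', Category.assoc, wreathInl_whiskerRight_wreathMul h]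

theorem tensor_wreathInr_wreathMul (h : IsDistributiveLaw x) {Z : C} (f : Z ⟶ Y ⊗ B) :
    (f ⊗ₘ wreathInr Y B) ≫ wreathMul x = f ▷ B ≫ (α_ Y B B).hom ≫ Y ◁ μ[B] := by
  rw [MonoidalCategory.tensorHom_def, Category.assoc, wreathInr_whiskerLeft_wreathMul h]

theorem wreathInl_tensor_wreathInr_wreathMul (h : IsDistributiveLaw x) :
    (wreathInl Y B ⊗ₘ wreathInr Y B) ≫ wreathMul x = 𝟙 _ := by
  rw [wreathInl_tensor_wreathMul h, wreathInr]
  calc _ = 𝟙 _ ⊗≫ (Y ◁ η[Y] ≫ μ[Y]) ▷ B := by monoidal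
    _ = _ := by rw [MonObj.mul_one]; monoidal

theorem wreathInr_tensor_wreathInl_wreathMul :
    (wreathInr Y B ⊗ₘ wreathInl Y B) ≫ wreathMul x = x := by
  have e₁ := MonObj.one_mul Y
  have e₂ := MonObj.mul_one B
  calc _ = 𝟙 _ ⊗≫ (B ⊗ Y) ◁ η[B] ⊗≫ (η[Y] ▷ (B ⊗ Y) ≫ Y ◁ x) ▷ B ⊗≫
          (μ[Y] ▷ (B ⊗ B) ≫ Y ◁ μ[B]) := by
        rw [wreathMul, MonoidalCategory.tensorHom_def μ[Y] μ[B],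
          MonoidalCategory.tensorHom_def' (wreathInr Y B), wreathInl, wreathInr]
        monoidal
    _ = 𝟙 _ ⊗≫ ((B ⊗ Y) ◁ η[B] ≫ x ▷ B) ⊗≫ (η[Y] ▷ Y ≫ μ[Y]) ▷ (B ⊗ B) ⊗≫ Y ◁ μ[B] := by
        rw [← whisker_exchange]; monoidal
    _ = 𝟙 _ ⊗≫ x ⊗≫ Y ◁ (B ◁ η[B] ≫ μ[B]) := by
        rw [whisker_exchange, e₁]; monoidal
    _ = _ := by rw [e₂]; monoidal

theorem mul_wreathInl (h : IsDistributiveLaw x) :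
    μ[Y] ≫ wreathInl Y B = (wreathInl Y B ⊗ₘ wreathInl Y B) ≫ wreathMul x := by
  rw [wreathInl_tensor_wreathMul h, wreathInl]
  calc _ = 𝟙 _ ⊗≫ (μ[Y] ▷ 𝟙_ C ≫ Y ◁ η[B]) ⊗≫ 𝟙 _ := by monoidal
    _ = _ := by rw [← whisker_exchange]; monoidal

theorem mul_wreathInr (h : IsDistributiveLaw x) :
    μ[B] ≫ wreathInr Y B = (wreathInr Y B ⊗ₘ wreathInr Y B) ≫ wreathMul x := by
  rw [tensor_wreathInr_wreathMul h, wreathInr]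
  calc _ = 𝟙 _ ⊗≫ (𝟙_ C ◁ μ[B] ≫ η[Y] ▷ B) ⊗≫ 𝟙 _ := by monoidal
    _ = _ := by rw [whisker_exchange]; monoidal

end Wreath

/-! ### Functoriality of relative pullbacks -/

section MapBetweenPullbacks

variable {D : Type u} [Category.{v} D] {S : SpanClass D} [IsAdmissible S]

namespace ChosenRelPullbacks

variable (pb : ChosenRelPullbacks S) {A B E A₁ B₁ E₁ : D} {f : A ⟶ B} {g : E ⟶ B} {f₁ : A₁ ⟶ B₁}
  {g₁ : E₁ ⟶ B₁} (hf : S (𝟙 A) f) (hg : S g (𝟙 E)) (hf₁ : S (𝟙 A₁) f₁) (hg₁ : S g₁ (𝟙 E₁))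

/-- The morphism between relative pullbacks that is induced by a morphism of cospans. -/
noncomputable def map (a : A ⟶ A₁) (c : E ⟶ E₁) (b : B ⟶ B₁) (wa : a ≫ f₁ = f ≫ b)
    (wc : c ≫ g₁ = g ≫ b) : pb.obj f g hf hg ⟶ pb.obj f₁ g₁ hf₁ hg₁ :=
  pb.lift hf₁ hg₁ (pb.fst f g hf hg ≫ a) (pb.snd f g hf hg ≫ c)
    (IsAdmissible.post (pb.isRelPullback f g hf hg).mem a c)
    (by rw [Category.assoc, Category.assoc, wa, wc, ← Category.assoc,
      (pb.isRelPullback f g hf hg).w, Category.assoc])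

theorem map_fst (a : A ⟶ A₁) (c : E ⟶ E₁) (b : B ⟶ B₁) (wa : a ≫ f₁ = f ≫ b)
    (wc : c ≫ g₁ = g ≫ b) : pb.map hf hg hf₁ hg₁ a c b wa wc ≫ pb.fst f₁ g₁ hf₁ hg₁ =
      pb.fst f g hf hg ≫ a :=
  pb.lift_fst _ _ _ _ _ _

theorem map_snd (a : A ⟶ A₁) (c : E ⟶ E₁) (b : B ⟶ B₁) (wa : a ≫ f₁ = f ≫ b)
    (wc : c ≫ g₁ = g ≫ b) : pb.map hf hg hf₁ hg₁ a c b wa wc ≫ pb.snd f₁ g₁ hf₁ hg₁ =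
      pb.snd f g hf hg ≫ c :=
  pb.lift_snd _ _ _ _ _ _

theorem isIso_map (a : A ⟶ A₁) (c : E ⟶ E₁) (b : B ⟶ B₁) (wa : a ≫ f₁ = f ≫ b)
    (wc : c ≫ g₁ = g ≫ b) [IsIso a] [IsIso c] [IsIso b] :
    IsIso (pb.map hf hg hf₁ hg₁ a c b wa wc) := by
  refine ⟨pb.map hf₁ hg₁ hf hg (inv a) (inv c) (inv b) (by simp [wa]) (by simp [wc]), ?_, ?_⟩
  · apply pb.hom_ext hf hg
    · rw [Category.assoc, map_fst, ← Category.assoc, map_fst]; simp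
    · rw [Category.assoc, map_snd, ← Category.assoc, map_snd]; simp
  · apply pb.hom_ext hf₁ hg₁
    · rw [Category.assoc, map_fst, ← Category.assoc, map_fst]; simp
    · rw [Category.assoc, map_snd, ← Category.assoc, map_snd]; simp

end ChosenRelPullbacks

namespace ReflGraph

variable (pb : ChosenRelPullbacks S) (G : ReflGraph S) (P : PointedOver S G.B)

theorem oneBox_p₁ : G.oneBox pb P ≫ G.p₁ pb P = 𝟙 _ := by
  rw [oneBox, boxLift_p₁]

theorem oneBox_p₂ : G.oneBox pb P ≫ G.p₂ pb P = G.s ≫ P.j := by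
  rw [oneBox, boxLift_p₂]

theorem boxOne_p₁ : G.boxOne pb P ≫ G.p₁ pb P = P.t ≫ G.i := by
  rw [boxOne, boxLift_p₁]

theorem boxOne_p₂ : G.boxOne pb P ≫ G.p₂ pb P = 𝟙 _ := by
  rw [boxOne, boxLift_p₂]

variable (d : G.AA pb ⟶ G.A)

theorem oneBoxComp_p₁ (hd : d ≫ G.t = G.p₁ pb _ ≫ G.t) :
    G.oneBoxComp pb d hd ≫ G.p₁ pb G.selfOver = G.p₁ pb (G.boxOver pb G.selfOver) := by
  rw [oneBoxComp, boxLift_p₁]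

theorem oneBoxComp_p₂ (hd : d ≫ G.t = G.p₁ pb _ ≫ G.t) :
    G.oneBoxComp pb d hd ≫ G.p₂ pb G.selfOver = G.p₂ pb (G.boxOver pb G.selfOver) ≫ d := by
  rw [oneBoxComp, boxLift_p₂]

theorem compBoxOne_p₁ (hd : d ≫ G.s = G.p₂ pb _ ≫ G.s) :
    G.compBoxOne pb d hd ≫ G.p₁ pb G.selfOver = G.p₁₂ pb ≫ d := by
  rw [compBoxOne, boxLift_p₁]

theorem compBoxOne_p₂ (hd : d ≫ G.s = G.p₂ pb _ ≫ G.s) :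
    G.compBoxOne pb d hd ≫ G.p₂ pb G.selfOver =
      G.p₂ pb (G.boxOver pb G.selfOver) ≫ G.p₂ pb G.selfOver := by
  rw [compBoxOne, boxLift_p₂, p₃]

end ReflGraph

end MapBetweenPullbacks

section Monoids

variable {C : Type u} [Category.{v} C] [MonoidalCategory C]

local infixl:75 " ⋆ " => extMul

variable {S : SpanClass C} [IsAdmissible S] [IsMonoidalClass S]

/-! ### Relative pullbacks of monoids and the morphisms `q` -/

section Boxes

variable (pb : ChosenRelPullbacks S) (G : ReflGraph (monSpan S)) (P : PointedOver (monSpan S) G.B)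

/-- The projections of a relative pullback of monoids are jointly monic with respect to all
morphisms of the underlying category. -/
theorem box_hom_ext_hom {X : C} {h k : X ⟶ (G.box pb.mon P).X}
    (h₁ : h ≫ (G.p₁ pb.mon P).hom = k ≫ (G.p₁ pb.mon P).hom)
    (h₂ : h ≫ (G.p₂ pb.mon P).hom = k ≫ (G.p₂ pb.mon P).hom) : h = k :=
  pb.hom_ext _ _ h₁ h₂

/-- The projection `A □_B I ⟶ I`. -/
noncomputable def pI : (AI pb G).X ⟶ 𝟙_ C :=
  (pb.mon.snd G.s (default : Mon.trivial C ⟶ G.B) G.mem_s (mem_unit G.B)).hom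

theorem isMonHom_pI : IsMonHom (pI pb G) :=
  (pb.mon.snd G.s (default : Mon.trivial C ⟶ G.B) G.mem_s (mem_unit G.B)).isMonHom_hom

theorem isRelPullback_AI : IsRelPullback S G.s.hom η[G.B.X] (pA pb G).hom (pI pb G) :=
  pb.isRelPullback G.s.hom η[G.B.X] (left_leg G.mem_s) (right_leg (mem_unit G.B))

theorem pA_s : (pA pb G).hom ≫ G.s.hom = pI pb G ≫ η[G.B.X] := (isRelPullback_AI pb G).w

/-- Since `q₁` is `m.(p_A i)`, its invertibility says that multiplication exhibits `A` as a product
of `A □_B I` and `B`. -/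
theorem qOne_eq : qOne pb G = (pA pb G).hom ⋆ G.i.hom := rfl

theorem i_s_hom : G.i.hom ≫ G.s.hom = 𝟙 G.B.X := congrArg Mon.Hom.hom G.i_s

theorem i_t_hom : G.i.hom ≫ G.t.hom = 𝟙 G.B.X := congrArg Mon.Hom.hom G.i_t

theorem oneBox_p₁_hom :
    (G.oneBox pb.mon P).hom ≫ (G.p₁ pb.mon P).hom = 𝟙 G.A.X :=
  congrArg Mon.Hom.hom (G.oneBox_p₁ pb.mon P)

theorem oneBox_p₂_hom :
    (G.oneBox pb.mon P).hom ≫ (G.p₂ pb.mon P).hom = G.s.hom ≫ P.j.hom :=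
  congrArg Mon.Hom.hom (G.oneBox_p₂ pb.mon P)

theorem boxOne_p₁_hom :
    (G.boxOne pb.mon P).hom ≫ (G.p₁ pb.mon P).hom = P.t.hom ≫ G.i.hom :=
  congrArg Mon.Hom.hom (G.boxOne_p₁ pb.mon P)

theorem boxOne_p₂_hom :
    (G.boxOne pb.mon P).hom ≫ (G.p₂ pb.mon P).hom = 𝟙 P.X.X :=
  congrArg Mon.Hom.hom (G.boxOne_p₂ pb.mon P)

/-- The two factors of `q_{n+1}` are morphisms of monoids with known components, whence the
components of `q_{n+1}` can be computed factor by factor. -/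
theorem qBox_eq : qBox pb G P =
    ((pA pb G).hom ≫ (G.oneBox pb.mon P).hom) ⋆ (G.boxOne pb.mon P).hom :=
  whiskerRight_extMul ..

theorem qBox_p₁ : qBox pb G P ≫ (G.p₁ pb.mon P).hom = (pA pb G).hom ⋆ (P.t.hom ≫ G.i.hom) := by
  rw [qBox_eq, extMul_comp_hom, Category.assoc, oneBox_p₁_hom, boxOne_p₁_hom, Category.comp_id]

theorem qBox_p₂ : qBox pb G P ≫ (G.p₂ pb.mon P).hom = pI pb G ▷ P.X.X ≫ (λ_ P.X.X).hom := by
  rw [qBox_eq, extMul_comp_hom, Category.assoc, oneBox_p₂_hom, boxOne_p₂_hom,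
    ← Category.assoc, pA_s, Category.assoc, IsMonHom.one_hom, ← whiskerRight_extMul, one_extMul,
    Category.comp_id]

end Boxes

/-! ### The monoid `Y B` and the morphisms `b` -/

namespace CrossedData

variable (M : CrossedData S)

/-- The inclusion `1 u : Y ⟶ Y B` as a morphism of monoids. -/
def inl : M.Y ⟶ M.YB where
  hom := wreathInl M.Y.X M.B.X
  isMonHom_hom := ⟨one_wreathInl, mul_wreathInl M.distributive⟩

/-- The inclusion `u 1 : B ⟶ Y B` as a morphism of monoids. -/
def inr : M.B ⟶ M.YB where
  hom := wreathInr M.Y.X M.B.X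
  isMonHom_hom := ⟨one_wreathInr, mul_wreathInr M.distributive⟩

theorem inl_extMul_inr : M.inl.hom ⋆ M.inr.hom = 𝟙 M.YB.X :=
  wreathInl_tensor_wreathInr_wreathMul M.distributive

theorem inr_extMul_inl : M.inr.hom ⋆ M.inl.hom = M.x :=
  wreathInr_tensor_wreathInl_wreathMul

theorem inl_extMul {Z : C} (g : Z ⟶ M.YB.X) : M.inl.hom ⋆ g = M.Y.X ◁ g ≫ M.mOne :=
  wreathInl_tensor_wreathMul M.distributive g

theorem mOne_eq : M.mOne = M.inl.hom ⋆ 𝟙 M.YB.X := by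
  rw [inl_extMul]
  erw [whiskerLeft_id, Category.id_comp]

theorem inl_eB : M.inl.hom ≫ M.eOne M.B.X = M.e ≫ η[M.B.X] := by
  change wreathInl M.Y.X M.B.X ≫ _ = _
  rw [eOne, wreathInl, Category.assoc, whisker_exchange_assoc, leftUnitor_naturality,
    ← Category.assoc, ← Category.assoc]
  congr 1
  simp [unitors_equal]

theorem inr_eB : M.inr.hom ≫ M.eOne M.B.X = 𝟙 _ := by
  have := M.e_isMonHom
  have h : η[M.Y.X] ≫ M.e = 𝟙 _ := IsMonHom.one_hom M.e
  change wreathInr M.Y.X M.B.X ≫ _ = _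
  rw [eOne, wreathInr, Category.assoc, ← comp_whiskerRight_assoc, h]
  simp

theorem inl_kB : M.inl.hom ≫ M.kMul 1 = M.k := by
  change wreathInl M.Y.X M.B.X ≫ (M.k ⋆ 𝟙 M.B.X) = _
  rw [wreathInl, Category.assoc, whiskerLeft_extMul, Category.comp_id, extMul_one,
    Iso.inv_hom_id_assoc]

theorem inr_kB : M.inr.hom ≫ M.kMul 1 = 𝟙 _ := by
  have := M.k_isMonHom
  change wreathInr M.Y.X M.B.X ≫ (M.k ⋆ 𝟙 M.B.X) = _
  rw [wreathInr, Category.assoc, whiskerRight_extMul, IsMonHom.one_hom, one_extMul,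
    Iso.inv_hom_id_assoc]

/-- Morphisms of monoids from `Y` and `B` that are compatible with `x` induce a morphism of
monoids from `Y B`. -/
def desc {A : Mon C} (p : M.Y ⟶ A) (j : M.B ⟶ A) (hx : M.x ≫ (p.hom ⋆ j.hom) = j.hom ⋆ p.hom) :
    M.YB ⟶ A where
  hom := p.hom ⋆ j.hom
  isMonHom_hom := ⟨wreathOne_extMul _ _, wreathMul_extMul _ _ hx⟩

variable (pb : ChosenRelPullbacks S)

theorem eOne_naturality {Z W : C} (g : Z ⟶ W) : M.Y.X ◁ g ≫ M.eOne W = M.eOne Z ≫ g := by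
  rw [eOne, eOne, whisker_exchange_assoc, leftUnitor_naturality, Category.assoc]

/-- The morphism `Y Z ⟶ (Y B) □_B Z` with components `1 κ` and `e 1` for an object `Z` over `B`
via `κ : Z ⟶ B`. The morphisms `b_{n+1}` are the case `Z = Y^n B`. -/
noncomputable def bOver {Z : C} (κ : Z ⟶ M.B.X) (hκ : S κ (𝟙 Z)) :
    M.Y.X ⊗ Z ⟶ pb.obj (M.eOne M.B.X) κ M.mem_eOne hκ :=
  pb.lift M.mem_eOne hκ (M.Y.X ◁ κ) (M.eOne Z)
    (by
      have h := IsAdmissible.post (IsMonoidalClass.multiplicative M.mem_e hκ)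
        (𝟙 (M.Y.X ⊗ M.B.X)) (λ_ Z).hom
      rwa [Category.comp_id, id_tensorHom, tensorHom_id] at h)
    (M.eOne_naturality κ)

theorem b_eq_bOver (n : ℕ) : M.b pb n = M.bOver pb (M.kMul n) (M.mem_kMul n) := rfl

theorem bOver_fst {Z : C} (κ : Z ⟶ M.B.X) (hκ : S κ (𝟙 Z)) :
    M.bOver pb κ hκ ≫ pb.fst _ _ M.mem_eOne hκ = M.Y.X ◁ κ :=
  pb.lift_fst ..

theorem bOver_snd {Z : C} (κ : Z ⟶ M.B.X) (hκ : S κ (𝟙 Z)) :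
    M.bOver pb κ hκ ≫ pb.snd _ _ M.mem_eOne hκ = M.eOne Z :=
  pb.lift_snd ..

theorem f_fst : M.f pb ≫ pb.fst _ _ M.mem_eOne (mem_of_unit _ _) = M.inl.hom :=
  pb.lift_fst ..

theorem f_snd : M.f pb ≫ pb.snd _ _ M.mem_eOne (mem_of_unit _ _) = M.e :=
  pb.lift_snd ..

/-- The span `(1, e 1)` is already a relative pullback along the identity of `B`, so that `b₁` is
always invertible. -/
theorem isIso_bOver_id : IsIso (M.bOver pb (𝟙 M.B.X) M.mem_B) := by
  have h := M.bOver_fst pb (𝟙 M.B.X) M.mem_B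
  rw [whiskerLeft_id] at h
  refine ⟨pb.fst _ _ M.mem_eOne M.mem_B, h, ?_⟩
  apply pb.hom_ext
  · rw [Category.assoc, h, Category.id_comp, Category.comp_id]
  · rw [Category.assoc, bOver_snd, Category.id_comp, (pb.isRelPullback _ _ M.mem_eOne M.mem_B).w,
      Category.comp_id]

theorem isIso_b_zero : IsIso (M.b pb 0) := M.isIso_bOver_id pb

end CrossedData

/-! ### Comparison of the morphisms `b` and `q` -/

/-- A comparison of the data of a crossed module with a reflexive graph of monoids: a morphism
of monoids `β` between the objects `B` and a morphism `φ : Y ⟶ A □_B I` that relate `e` to the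
projection to `I` and `k` to `t`. Multiplicativity of `φ` is not needed. -/
structure Comparison (pb : ChosenRelPullbacks S) (M : CrossedData S)
    (G : ReflGraph (monSpan S)) where
  β : M.B ⟶ G.B
  φ : M.Y.X ⟶ (AI pb G).X
  φ_pI : φ ≫ pI pb G = M.e
  φ_t : φ ≫ (pA pb G).hom ≫ G.t.hom = M.k ≫ β.hom

namespace Comparison

variable {pb : ChosenRelPullbacks S} {M : CrossedData S} {G : ReflGraph (monSpan S)}
  (K : Comparison pb M G)

/-- The composite of `φ β : Y B ⟶ (A □_B I) B` with `q₁ = m.(p_A i)`. -/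
noncomputable def ψ : M.Y.X ⊗ M.B.X ⟶ G.A.X := (K.φ ⊗ₘ K.β.hom) ≫ qOne pb G

theorem ψ_eq : K.ψ = (K.φ ≫ (pA pb G).hom) ⋆ (K.β.hom ≫ G.i.hom) := by
  rw [ψ, qOne_eq, tensorHom_extMul]

theorem φ_pA_s : (K.φ ≫ (pA pb G).hom) ≫ G.s.hom = M.e ≫ η[G.B.X] := by
  rw [Category.assoc, pA_s, ← Category.assoc, φ_pI]

theorem ψ_s : K.ψ ≫ G.s.hom = M.eOne M.B.X ≫ K.β.hom := by
  rw [ψ_eq, extMul_comp_hom, φ_pA_s, Category.assoc, i_s_hom, Category.comp_id,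
    ← whiskerRight_extMul, one_extMul, CrossedData.eOne, Category.assoc]

theorem extMul_t {Z : C} (κ : Z ⟶ M.B.X) : ((K.φ ≫ (pA pb G).hom) ⋆ (κ ≫ K.β.hom ≫ G.i.hom)) ≫
    G.t.hom = (M.k ⋆ κ) ≫ K.β.hom := by
  rw [extMul_comp_hom, extMul_comp_hom, Category.assoc, φ_t, Category.assoc, Category.assoc,
    i_t_hom, Category.comp_id]

theorem ψ_t : K.ψ ≫ G.t.hom = M.kMul 1 ≫ K.β.hom := by
  have h := K.extMul_t (𝟙 M.B.X)
  rw [Category.id_comp, ← ψ_eq] at h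
  exact h

section Step

variable {Z : C} {κ : Z ⟶ M.B.X} (hκ : S κ (𝟙 Z)) (P : PointedOver (monSpan S) G.B)
  (c : Z ⟶ P.X.X)

theorem tensor_qBox_p₁ (hc : c ≫ P.t.hom = κ ≫ K.β.hom) :
    ((K.φ ⊗ₘ c) ≫ qBox pb G P) ≫ (G.p₁ pb.mon P).hom =
    M.Y.X ◁ κ ≫ K.ψ := by
  rw [Category.assoc, qBox_p₁, tensorHom_extMul, ← Category.assoc c, hc, ψ_eq, whiskerLeft_extMul,
    Category.assoc κ]

theorem tensor_qBox_p₂ : ((K.φ ⊗ₘ c) ≫ qBox pb G P) ≫ (G.p₂ pb.mon P).hom = M.eOne Z ≫ c := by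
  rw [Category.assoc, qBox_p₂, MonoidalCategory.tensorHom_def', Category.assoc,
    ← comp_whiskerRight_assoc, φ_pI]
  exact M.eOne_naturality c

theorem tensor_qBox_t (hc : c ≫ P.t.hom = κ ≫ K.β.hom) :
    ((K.φ ⊗ₘ c) ≫ qBox pb G P) ≫ (G.boxOver pb.mon P).t.hom =
    (M.k ⋆ κ) ≫ K.β.hom := by
  have h := K.tensor_qBox_p₁ P c hc
  have h' := K.extMul_t κ
  rw [← whiskerLeft_extMul, ← ψ_eq, ← h, Category.assoc] at h'
  exact h'

/-- The morphism `(Y B) □_B Z ⟶ A □_B P` that is induced by `ψ` and `c`. -/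
noncomputable def boxMap (hc : c ≫ P.t.hom = κ ≫ K.β.hom) :
    pb.obj (M.eOne M.B.X) κ M.mem_eOne hκ ⟶ (G.box pb.mon P).X :=
  pb.map _ _ (left_leg G.mem_s) (right_leg P.mem) K.ψ c K.β.hom K.ψ_s hc

theorem boxMap_p₁ (hc : c ≫ P.t.hom = κ ≫ K.β.hom) :
    K.boxMap hκ P c hc ≫ (G.p₁ pb.mon P).hom =
    pb.fst _ _ M.mem_eOne hκ ≫ K.ψ := pb.map_fst ..

theorem boxMap_p₂ (hc : c ≫ P.t.hom = κ ≫ K.β.hom) :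
    K.boxMap hκ P c hc ≫ (G.p₂ pb.mon P).hom =
    pb.snd _ _ M.mem_eOne hκ ≫ c := pb.map_snd ..

theorem isIso_boxMap (hc : c ≫ P.t.hom = κ ≫ K.β.hom) [IsIso K.β.hom] [IsIso K.ψ]
    [IsIso c] : IsIso (K.boxMap hκ P c hc) :=
  ChosenRelPullbacks.isIso_map ..

/-- The comparison morphisms intertwine the morphisms `b` with the morphisms `q`. -/
theorem bOver_boxMap (hc : c ≫ P.t.hom = κ ≫ K.β.hom) :
    M.bOver pb κ hκ ≫ K.boxMap hκ P c hc = (K.φ ⊗ₘ c) ≫ qBox pb G P := by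
  apply box_hom_ext_hom
  · rw [Category.assoc, boxMap_p₁, ← Category.assoc, CrossedData.bOver_fst,
      K.tensor_qBox_p₁ P c hc]
  · rw [Category.assoc, boxMap_p₂, ← Category.assoc, CrossedData.bOver_snd, K.tensor_qBox_p₂]

end Step

/-- The morphisms `Y^n B ⟶ A^{□ n}` obtained by iterating the canonical morphisms `q`. -/
noncomputable def c : ∀ n : ℕ, M.YnB n ⟶ (G.pow pb.mon n).X.X
  | 0 => K.β.hom
  | n + 1 => (K.φ ⊗ₘ c n) ≫ q pb G n

theorem c_t : ∀ n : ℕ, K.c n ≫ (G.pow pb.mon n).t.hom = M.kMul n ≫ K.β.hom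
  | 0 => (Category.comp_id _).trans (Category.id_comp _).symm
  | 1 => K.ψ_t
  | n + 2 => K.tensor_qBox_t (G.powSucc pb.mon n) (K.c (n + 1)) (c_t (n + 1))

theorem b_boxMap (n : ℕ) : M.b pb (n + 1) ≫
    K.boxMap (M.mem_kMul (n + 1)) (G.powSucc pb.mon n) (K.c (n + 1)) (K.c_t (n + 1)) =
      K.c (n + 2) :=
  K.bOver_boxMap (M.mem_kMul (n + 1)) (G.powSucc pb.mon n) (K.c (n + 1)) (K.c_t (n + 1))

/-- If the morphisms `q` are invertible, then so are their iterates. -/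
theorem isIso_c_of_q [IsIso K.β.hom] [IsIso K.φ] (h : ∀ n, IsIso (q pb G n)) : ∀ n, IsIso (K.c n)
  | 0 => inferInstanceAs (IsIso K.β.hom)
  | n + 1 => by
    have := isIso_c_of_q h n
    exact @IsIso.comp_isIso _ _ _ _ _ _ _ (MonoidalCategory.tensor_isIso K.φ (K.c n)) (h n)

/-- If the comparison morphisms are invertible, then invertibility of the morphisms `q` implies that
of the morphisms `b`: `b_{n+2}` differs from the invertible iterate `c (n + 2)` by the invertible
`boxMap`. -/
theorem isIso_b_of_q [IsIso K.β.hom] [IsIso K.φ] (h : ∀ n, IsIso (q pb G n)) :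
    ∀ n, IsIso (M.b pb n)
  | 0 => M.isIso_b_zero pb
  | n + 1 => by
    have hc := K.isIso_c_of_q h
    have : IsIso K.ψ := hc 1
    have : IsIso (Y := (G.powSucc pb.mon n).X.X) (K.c (n + 1)) := hc (n + 1)
    have h₁ := K.isIso_boxMap (M.mem_kMul (n + 1)) (G.powSucc pb.mon n) (K.c (n + 1))
      (K.c_t (n + 1))
    have h₂ := hc (n + 2)
    rw [← b_boxMap] at h₂
    exact @IsIso.of_isIso_comp_right _ _ _ _ _ _ _ h₁ h₂

theorem isIso_c_of_b [IsIso K.β.hom] [hψ : IsIso K.ψ] (h : ∀ n, IsIso (M.b pb n)) :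
    ∀ n, IsIso (K.c n)
  | 0 => inferInstanceAs (IsIso K.β.hom)
  | 1 => hψ
  | n + 2 => by
    have : IsIso (Y := (G.powSucc pb.mon n).X.X) (K.c (n + 1)) := isIso_c_of_b h (n + 1)
    have h₁ := K.isIso_boxMap (M.mem_kMul (n + 1)) (G.powSucc pb.mon n) (K.c (n + 1))
      (K.c_t (n + 1))
    rw [← b_boxMap]
    exact @IsIso.comp_isIso _ _ _ _ _ _ _ (h (n + 1)) h₁

/-- The converse of `isIso_b_of_q`, for which `ψ`, hence `q₁`, has to be known to be invertible. -/
theorem isIso_q_of_b [IsIso K.β.hom] [IsIso K.φ] [IsIso K.ψ] (h : ∀ n, IsIso (M.b pb n))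
    (n : ℕ) : IsIso (q pb G n) := by
  have hc := K.isIso_c_of_b h
  have := hc n
  have h₂ : IsIso ((K.φ ⊗ₘ K.c n) ≫ q pb G n) := hc (n + 1)
  exact IsIso.of_isIso_comp_left (K.φ ⊗ₘ K.c n) _

end Comparison

/-! ### The relative category of a crossed module -/

namespace CrossedData

variable (M : CrossedData S)

/-- The reflexive graph of monoids on `Y B` and `B` with `s = e 1`, `t = m.(k 1)` and `i = u 1`. -/
def reflGraph : ReflGraph (monSpan S) where
  B := M.B
  A := M.YB
  s := M.eB
  t := M.kB
  i := M.inr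
  i_s := Mon.Hom.ext M.inr_eB
  i_t := Mon.Hom.ext M.inr_kB
  mem_s := M.mem_eOne
  mem_t := M.mem_kMul 1

variable (pb : ChosenRelPullbacks S)

/-- The comparison of a crossed module with its own reflexive graph. -/
noncomputable def selfComparison : Comparison pb M M.reflGraph where
  β := 𝟙 M.B
  φ := M.f pb
  φ_pI := M.f_snd pb
  φ_t := by
    have h : M.f pb ≫ (pA pb M.reflGraph).hom = M.inl.hom := M.f_fst pb
    have h' := congrArg (fun z => z ≫ M.kMul 1) h
    exact ((Category.assoc _ _ _).symm.trans h').trans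
      (M.inl_kB.trans (Category.comp_id _).symm)

theorem selfComparison_φ_pA :
    (M.selfComparison pb).φ ≫ (pA pb M.reflGraph).hom = M.inl.hom :=
  M.f_fst pb

/-- For the reflexive graph on `Y B`, the comparison morphism `ψ` is `m.(1 u)(u 1) = 1`. -/
theorem selfComparison_ψ : (M.selfComparison pb).ψ = 𝟙 M.YB.X := by
  rw [Comparison.ψ_eq, selfComparison_φ_pA]
  exact (congrArg (fun z => M.inl.hom ⋆ z) (Category.id_comp M.inr.hom)).trans M.inl_extMul_inr

theorem isIso_q (hf : IsIso (M.f pb)) (h : ∀ n, IsIso (M.b pb n)) (n : ℕ) :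
    IsIso (q pb M.reflGraph n) := by
  have h₁ : IsIso (M.selfComparison pb).β.hom := inferInstanceAs (IsIso (𝟙 M.B.X))
  have h₂ : IsIso (M.selfComparison pb).φ := hf
  have h₃ : IsIso (M.selfComparison pb).ψ := by
    rw [selfComparison_ψ]
    exact inferInstanceAs (IsIso (𝟙 M.YB.X))
  exact (M.selfComparison pb).isIso_q_of_b h n

/-- The monoid `(Y B) □_B (Y B)`. -/
noncomputable abbrev AA : Mon C := M.reflGraph.AA pb.mon

/-- The first projection `(Y B) □_B (Y B) ⟶ Y B`. -/
noncomputable def π₁ : M.AA pb ⟶ M.YB := M.reflGraph.p₁ pb.mon M.reflGraph.selfOver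

/-- The second projection `(Y B) □_B (Y B) ⟶ Y B`. -/
noncomputable def π₂ : M.AA pb ⟶ M.YB := M.reflGraph.p₂ pb.mon M.reflGraph.selfOver

theorem AA_hom_ext {X : C} {h k : X ⟶ (M.AA pb).X} (h₁ : h ≫ (M.π₁ pb).hom = k ≫ (M.π₁ pb).hom)
    (h₂ : h ≫ (M.π₂ pb).hom = k ≫ (M.π₂ pb).hom) : h = k :=
  pb.hom_ext _ _ h₁ h₂

/-- The morphism of monoids `Y B ⟶ (Y B) □_B (Y B)` with components `1` and `i.s`. -/
noncomputable def unitRight : M.YB ⟶ M.AA pb :=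
  M.reflGraph.oneBox pb.mon M.reflGraph.selfOver

theorem unitRight_π₁ : (M.unitRight pb).hom ≫ (M.π₁ pb).hom = 𝟙 M.YB.X :=
  oneBox_p₁_hom pb M.reflGraph M.reflGraph.selfOver

theorem unitRight_π₂ : (M.unitRight pb).hom ≫ (M.π₂ pb).hom = M.eB.hom ≫ M.inr.hom :=
  oneBox_p₂_hom pb M.reflGraph M.reflGraph.selfOver

/-- The morphism of monoids `Y ⟶ (Y B) □_B (Y B)` with components `1 u` and `u u.e`. -/
noncomputable def left : M.Y ⟶ M.AA pb := M.inl ≫ M.unitRight pb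

/-- The morphism of monoids `Y B ⟶ (Y B) □_B (Y B)` with components `i.t` and `1`. -/
noncomputable def right : M.YB ⟶ M.AA pb := M.reflGraph.boxOne pb.mon M.reflGraph.selfOver

theorem left_π₁ : (M.left pb).hom ≫ (M.π₁ pb).hom = M.inl.hom := by
  rw [left, Mon.comp_hom', Category.assoc, unitRight_π₁, Category.comp_id]

theorem left_π₂ : (M.left pb).hom ≫ (M.π₂ pb).hom = M.e ≫ η[M.YB.X] := by
  have h : M.inl.hom ≫ M.eB.hom = M.e ≫ η[M.B.X] := M.inl_eB
  rw [left, Mon.comp_hom', Category.assoc, unitRight_π₂, ← Category.assoc, h, Category.assoc,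
    IsMonHom.one_hom]

theorem right_π₁ : (M.right pb).hom ≫ (M.π₁ pb).hom = M.kB.hom ≫ M.inr.hom :=
  boxOne_p₁_hom pb M.reflGraph M.reflGraph.selfOver

theorem right_π₂ : (M.right pb).hom ≫ (M.π₂ pb).hom = 𝟙 M.YB.X :=
  boxOne_p₂_hom pb M.reflGraph M.reflGraph.selfOver

/-- The morphism `b₂`, with source and target written in terms of the monoid `Y B`. -/
noncomputable def bYB : M.Y.X ⊗ M.YB.X ⟶ (M.AA pb).X := M.b₂ pb

theorem whiskerLeft_eq_extMul {Z : C} (κ : Z ⟶ M.B.X) :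
    (M.Y.X ◁ κ : M.Y.X ⊗ Z ⟶ M.YB.X) = M.inl.hom ⋆ (κ ≫ M.inr.hom) := by
  rw [← whiskerLeft_extMul, inl_extMul_inr]
  exact (Category.comp_id _).symm

theorem bYB_π₁ : M.bYB pb ≫ (M.π₁ pb).hom = M.inl.hom ⋆ (M.kB.hom ≫ M.inr.hom) :=
  (M.bOver_fst pb (M.kMul 1) (M.mem_kMul 1)).trans (M.whiskerLeft_eq_extMul M.kB.hom)

theorem bYB_π₂ : M.bYB pb ≫ (M.π₂ pb).hom = M.e ▷ M.YB.X ≫ (λ_ M.YB.X).hom :=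
  M.bOver_snd pb (M.kMul 1) (M.mem_kMul 1)

/-- The morphism `b₂` is multiplication along two morphisms of monoids. This brings it into the scope
of `isMonHom_of_factorization`. -/
theorem bYB_eq : M.bYB pb = (M.left pb).hom ⋆ (M.right pb).hom := by
  apply M.AA_hom_ext pb
  · rw [bYB_π₁, extMul_comp_hom, left_π₁, right_π₁]
  · rw [bYB_π₂, extMul_comp_hom, left_π₂, right_π₂, ← whiskerRight_extMul, one_extMul,
      Category.comp_id]

theorem one_bYB : ((λ_ M.YB.X).inv ≫ η[M.Y.X] ▷ M.YB.X) ≫ M.bYB pb = (M.right pb).hom := by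
  rw [bYB_eq, one_extMul_inv]

theorem bYB_one : ((ρ_ M.Y.X).inv ≫ M.Y.X ◁ η[M.YB.X]) ≫ M.bYB pb = (M.left pb).hom := by
  rw [bYB_eq, extMul_one_inv]

/-- The left action `m 1 : Y Y B ⟶ Y B` of `Y` on the monoid `Y B`. -/
def act : M.Y.X ⊗ M.YB.X ⟶ M.YB.X := M.inl.hom ⋆ 𝟙 M.YB.X

theorem mOne_eq_act : M.mOne = M.act := M.mOne_eq

/-- The Peiffer condition says that the composition is given by multiplication also on the products
in the order opposite to that in `b₂`. -/
theorem peiffer_iff [IsIso (M.bYB pb)] : haveI : IsIso (M.b₂ pb) := ‹IsIso (M.bYB pb)›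
    M.Peiffer pb ↔
      ((M.right pb).hom ⋆ (M.left pb).hom) ≫ inv (M.bYB pb) ≫ M.act = 𝟙 M.YB.X ⋆ M.inl.hom := by
  have h₁ : (((λ_ M.YB.X).inv ≫ η[M.Y.X] ▷ M.YB.X) ⊗ₘ ((ρ_ M.Y.X).inv ≫ M.Y.X ◁ η[M.YB.X])) ≫
      (M.bYB pb ⊗ₘ M.bYB pb) ≫ μ[(M.AA pb).X] ≫ inv (M.bYB pb) ≫ M.act =
      ((M.right pb).hom ⋆ (M.left pb).hom) ≫ inv (M.bYB pb) ≫ M.act := by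
    rw [MonoidalCategory.tensorHom_comp_tensorHom_assoc, one_bYB, bYB_one, extMul,
      Category.assoc]
  have h₂ : (α_ M.Y.X M.B.X M.Y.X).hom ≫ M.Y.X ◁ (M.inr.hom ⋆ M.inl.hom) ≫ M.act =
      (M.inl.hom ⋆ M.inr.hom) ⋆ M.inl.hom := by
    rw [act, whiskerLeft_extMul, Category.comp_id, extMul_assoc]
  rw [inr_extMul_inl, inl_extMul_inr] at h₂
  rw [← h₁]
  exact Eq.congr (congrArg (fun z => (((λ_ M.YB.X).inv ≫ η[M.Y.X] ▷ M.YB.X) ⊗ₘ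
    ((ρ_ M.Y.X).inv ≫ M.Y.X ◁ η[M.YB.X])) ≫ (M.bYB pb ⊗ₘ M.bYB pb) ≫ μ[(M.AA pb).X] ≫
      inv (M.bYB pb) ≫ z) M.mOne_eq_act)
    ((congrArg (fun z => (α_ M.Y.X M.B.X M.Y.X).hom ≫ M.Y.X ◁ M.x ≫ z) M.mOne_eq_act).trans h₂)

section Composition

variable {M pb} (h : IsCrossedModule pb M)

theorem isIso_bYB (h : IsCrossedModule pb M) : IsIso (M.bYB pb) := h.b_isIso 1

/-- The composition `m 1.b₂⁻¹ : (Y B) □_B (Y B) ⟶ Y B` as a morphism of monoids. -/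
noncomputable def comp : M.AA pb ⟶ M.YB where
  hom := haveI := isIso_bYB h
    inv (M.bYB pb) ≫ M.act
  isMonHom_hom := by
    have := isIso_bYB h
    have : IsIso ((M.left pb).hom ⋆ (M.right pb).hom) := by rw [← bYB_eq]; infer_instance
    refine isMonHom_of_factorization (M.left pb).hom (M.right pb).hom M.inl.hom _ ?_
      ((M.peiffer_iff pb).1 h.peiffer)
    rw [← bYB_eq, IsIso.hom_inv_id_assoc, act]

theorem bYB_comp : M.bYB pb ≫ (comp h).hom = M.act := by
  have := isIso_bYB h
  exact IsIso.hom_inv_id_assoc _ _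

theorem act_eB : M.act ≫ M.eB.hom = M.e ▷ M.YB.X ≫ (λ_ M.YB.X).hom ≫ M.eB.hom := by
  rw [act, extMul_comp_hom, Category.id_comp, ← one_extMul, whiskerRight_extMul]
  exact congrArg (fun z => z ⋆ M.eB.hom) M.inl_eB

theorem act_kB : M.act ≫ M.kB.hom = M.k ⋆ M.kB.hom := by
  rw [act, extMul_comp_hom, Category.id_comp]
  exact congrArg (fun z => z ⋆ M.kB.hom) M.inl_kB

theorem comp_s : (comp h).hom ≫ M.eB.hom = (M.π₂ pb).hom ≫ M.eB.hom := by
  have := isIso_bYB h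
  rw [← cancel_epi (M.bYB pb), ← Category.assoc, bYB_comp, ← Category.assoc, bYB_π₂, act_eB,
    Category.assoc]

theorem comp_t : (comp h).hom ≫ M.kB.hom = (M.π₁ pb).hom ≫ M.kB.hom := by
  have := isIso_bYB h
  have h₁ : M.inl.hom ≫ M.kB.hom = M.k := M.inl_kB
  have h₂ : M.inr.hom ≫ M.kB.hom = 𝟙 M.B.X := M.inr_kB
  rw [← cancel_epi (M.bYB pb), ← Category.assoc, bYB_comp, ← Category.assoc, bYB_π₁, act_kB,
    extMul_comp_hom, h₁, Category.assoc, h₂, Category.comp_id]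

theorem right_comp : (M.right pb).hom ≫ (comp h).hom = 𝟙 M.YB.X := by
  rw [← one_bYB, Category.assoc, bYB_comp, act, one_extMul_inv]

/-- The morphism `1 u 1 : Y B ⟶ Y (Y B)`. -/
def insertOne (M : CrossedData S) : M.YB.X ⟶ M.Y.X ⊗ M.YB.X := M.Y.X ◁ M.inr.hom

theorem insertOne_extMul (g : M.YB.X ⟶ M.YB.X) :
    M.insertOne ≫ (M.inl.hom ⋆ g) = M.inl.hom ⋆ (M.inr.hom ≫ g) :=
  whiskerLeft_extMul ..

theorem insertOne_eOne :
    M.insertOne ≫ M.e ▷ M.YB.X ≫ (λ_ M.YB.X).hom = M.eB.hom ≫ M.inr.hom :=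
  M.eOne_naturality M.inr.hom

/-- The morphism `1 □ i` factors through `b₂`. -/
theorem insertOne_bYB : M.insertOne ≫ M.bYB pb = (M.unitRight pb).hom := by
  have h₂ : M.inr.hom ≫ M.kB.hom = 𝟙 M.B.X := M.inr_kB
  apply M.AA_hom_ext pb
  · rw [unitRight_π₁, Category.assoc, bYB_π₁, insertOne_extMul, reassoc_of% h₂, inl_extMul_inr]
  · rw [unitRight_π₂, Category.assoc, bYB_π₂, insertOne_eOne]

theorem unitRight_comp : (M.unitRight pb).hom ≫ (comp h).hom = 𝟙 M.YB.X := by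
  rw [← insertOne_bYB, Category.assoc, bYB_comp, act, insertOne_extMul, Category.comp_id,
    inl_extMul_inr]

/-- The monoid `(Y B) □_B ((Y B) □_B (Y B))`. -/
noncomputable abbrev AAA (M : CrossedData S) (pb : ChosenRelPullbacks S) : Mon C :=
  M.reflGraph.AAA pb.mon

/-- The isomorphism `Y Y Y B ⟶ (Y B) □_B ((Y B) □_B (Y B))` obtained from `b₃` and `b₂`:
the latter identifies the second and third factors, the former splits off the first. -/
noncomputable def bYYB (M : CrossedData S) (pb : ChosenRelPullbacks S) :
    M.Y.X ⊗ (M.Y.X ⊗ M.YB.X) ⟶ (M.AAA pb).X :=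
  ((M.selfComparison pb).φ ⊗ₘ M.bYB pb) ≫ qBox pb M.reflGraph
    (M.reflGraph.boxOver pb.mon M.reflGraph.selfOver)

theorem bYB_boxOver_t :
    M.bYB pb ≫ (M.π₁ pb).hom ≫ M.kB.hom = M.kMul 2 ≫ (M.selfComparison pb).β.hom := by
  have h₁ : M.inl.hom ≫ M.kB.hom = M.k := M.inl_kB
  have h₂ : M.inr.hom ≫ M.kB.hom = 𝟙 M.B.X := M.inr_kB
  rw [← Category.assoc, bYB_π₁, extMul_comp_hom, h₁, Category.assoc, h₂, Category.comp_id]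
  exact (Category.comp_id _).symm

/-- The first projection from `(Y B) □_B ((Y B) □_B (Y B))`. -/
noncomputable def ρ₁ (M : CrossedData S) (pb : ChosenRelPullbacks S) : M.AAA pb ⟶ M.YB :=
  M.reflGraph.p₁ pb.mon (M.reflGraph.boxOver pb.mon M.reflGraph.selfOver)

/-- The second projection from `(Y B) □_B ((Y B) □_B (Y B))`. -/
noncomputable def ρ₂ (M : CrossedData S) (pb : ChosenRelPullbacks S) : M.AAA pb ⟶ M.AA pb :=
  M.reflGraph.p₂ pb.mon (M.reflGraph.boxOver pb.mon M.reflGraph.selfOver)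

theorem bYYB_ρ₁ : M.bYYB pb ≫ (M.ρ₁ pb).hom =
    M.inl.hom ⋆ ((M.k ⋆ M.kB.hom) ≫ M.inr.hom) := by
  refine ((M.selfComparison pb).tensor_qBox_p₁ (κ := M.kMul 2)
    (M.reflGraph.boxOver pb.mon M.reflGraph.selfOver) (M.bYB pb) bYB_boxOver_t).trans ?_
  rw [selfComparison_ψ]
  exact (Category.comp_id _).trans (M.whiskerLeft_eq_extMul (M.kMul 2))

theorem bYYB_ρ₂ : M.bYYB pb ≫ (M.ρ₂ pb).hom =
    M.e ▷ (M.Y.X ⊗ M.YB.X) ≫ (λ_ (M.Y.X ⊗ M.YB.X)).hom ≫ M.bYB pb := by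
  refine ((M.selfComparison pb).tensor_qBox_p₂
    (M.reflGraph.boxOver pb.mon M.reflGraph.selfOver) (M.bYB pb)).trans ?_
  exact Category.assoc _ _ _

theorem isIso_bYYB (h : IsCrossedModule pb M) : IsIso (M.bYYB pb) := by
  have h₁ := (M.selfComparison pb).bOver_boxMap (M.mem_kMul 2)
    (M.reflGraph.boxOver pb.mon M.reflGraph.selfOver) (M.bYB pb) bYB_boxOver_t
  have : IsIso (M.selfComparison pb).β.hom := inferInstanceAs (IsIso (𝟙 M.B.X))
  have : IsIso (M.selfComparison pb).ψ := by
    rw [selfComparison_ψ]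
    exact inferInstanceAs (IsIso (𝟙 M.YB.X))
  have h₂ := @Comparison.isIso_boxMap _ _ _ _ _ _ _ _ _ (M.selfComparison pb) _ _ (M.mem_kMul 2)
    (M.reflGraph.boxOver pb.mon M.reflGraph.selfOver) (M.bYB pb) bYB_boxOver_t _ _ (isIso_bYB h)
  have h₃ : IsIso (M.b pb 2) := h.b_isIso 2
  have h₄ := @IsIso.comp_isIso _ _ _ _ _ _ _ h₃ h₂
  rw [b_eq_bOver] at h₄
  exact (congrArg (fun z => IsIso z) h₁).mp h₄

/-- The first two of three factors. -/
noncomputable def ρ₁₂ (M : CrossedData S) (pb : ChosenRelPullbacks S) : M.AAA pb ⟶ M.AA pb :=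
  M.reflGraph.p₁₂ pb.mon

theorem ρ₁₂_π₁ : (M.ρ₁₂ pb).hom ≫ (M.π₁ pb).hom = (M.ρ₁ pb).hom :=
  congrArg Mon.Hom.hom (M.reflGraph.p₁₂_p₁ pb.mon)

theorem ρ₁₂_π₂ : (M.ρ₁₂ pb).hom ≫ (M.π₂ pb).hom = (M.ρ₂ pb).hom ≫ (M.π₁ pb).hom :=
  congrArg Mon.Hom.hom (M.reflGraph.p₁₂_p₂ pb.mon)

theorem bYYB_ρ₁₂ : M.bYYB pb ≫ (M.ρ₁₂ pb).hom =
    M.Y.X ◁ (M.inl.hom ⋆ (M.kB.hom ≫ M.inr.hom)) ≫ M.bYB pb := by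
  have h₁ : M.inl.hom ≫ M.kB.hom = M.k := M.inl_kB
  have h₂ : M.inr.hom ≫ M.kB.hom = 𝟙 M.B.X := M.inr_kB
  apply M.AA_hom_ext pb
  · rw [Category.assoc, ρ₁₂_π₁, bYYB_ρ₁, Category.assoc, bYB_π₁, whiskerLeft_extMul,
      ← Category.assoc (_ ⋆ _), extMul_comp_hom _ _ M.kB, h₁, Category.assoc, h₂, Category.comp_id]
  · rw [Category.assoc, ρ₁₂_π₂, ← Category.assoc, bYYB_ρ₂, Category.assoc, Category.assoc, bYB_π₁,
      Category.assoc, bYB_π₂, whisker_exchange_assoc, leftUnitor_naturality]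

/-- The composition is associative. Here `f` and `g` are `1 □ d` and `d □ 1`. Precomposed with the
isomorphism `bYYB`, they become the two ways `1 m 1` and `m 1 1` of multiplying the three factors in
`Y (Y (Y B))`, so that the claim is the associativity of the action of `Y`. -/
theorem comp_assoc (f g : M.AAA pb ⟶ M.AA pb) (hf₁ : f.hom ≫ (M.π₁ pb).hom = (M.ρ₁ pb).hom)
    (hf₂ : f.hom ≫ (M.π₂ pb).hom = (M.ρ₂ pb).hom ≫ (comp h).hom)
    (hg₁ : g.hom ≫ (M.π₁ pb).hom = (M.ρ₁₂ pb).hom ≫ (comp h).hom)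
    (hg₂ : g.hom ≫ (M.π₂ pb).hom = (M.ρ₂ pb).hom ≫ (M.π₂ pb).hom) :
    f.hom ≫ (comp h).hom = g.hom ≫ (comp h).hom := by
  have hiso := isIso_bYYB h
  have h₁ : M.inl.hom ≫ M.kB.hom = M.k := M.inl_kB
  have ef : M.bYYB pb ≫ f.hom = M.Y.X ◁ M.act ≫ M.bYB pb := by
    apply M.AA_hom_ext pb
    · rw [Category.assoc, hf₁, bYYB_ρ₁, Category.assoc, bYB_π₁, whiskerLeft_extMul,
        ← Category.assoc M.act, act_kB]
    · rw [Category.assoc, hf₂, ← Category.assoc, bYYB_ρ₂, Category.assoc, Category.assoc, bYB_comp,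
        Category.assoc, bYB_π₂, whisker_exchange_assoc, leftUnitor_naturality]
  have eg : M.bYYB pb ≫ g.hom =
      ((α_ M.Y.X M.Y.X M.YB.X).inv ≫ μ[M.Y.X] ▷ M.YB.X) ≫ M.bYB pb := by
    have := M.e_isMonHom
    apply M.AA_hom_ext pb
    · rw [Category.assoc, hg₁, ← Category.assoc, bYYB_ρ₁₂, Category.assoc, bYB_comp, act,
        whiskerLeft_extMul, Category.comp_id, Category.assoc, bYB_π₁, Category.assoc,
        whiskerRight_extMul, mul_comp, extMul_assoc_inv]
    · have he : μ[M.Y.X] ≫ M.e = (M.e ⊗ₘ M.e) ≫ (λ_ (𝟙_ C)).hom := IsMonHom.mul_hom M.e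
      rw [Category.assoc, hg₂, ← Category.assoc, bYYB_ρ₂, Category.assoc, Category.assoc, bYB_π₂,
        Category.assoc, bYB_π₂, Category.assoc, ← comp_whiskerRight_assoc, he,
        MonoidalCategory.tensorHom_def]
      monoidal
  rw [← cancel_epi (M.bYYB pb), ← Category.assoc, ef, ← Category.assoc, eg, Category.assoc,
    bYB_comp, Category.assoc, bYB_comp, act, whiskerLeft_extMul, Category.comp_id, Category.assoc,
    whiskerRight_extMul, mul_comp, extMul_assoc_inv]

/-- The relative category of monoids of a crossed module, with underlying reflexive graph on
`Y B` and `B`. -/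
noncomputable def relCat (h : IsCrossedModule pb M) : RelCat pb.mon where
  toReflGraph := M.reflGraph
  d := comp h
  d_s := Mon.Hom.ext (comp_s h)
  d_t := Mon.Hom.ext (comp_t h)
  unit_left := Mon.Hom.ext (right_comp h)
  unit_right := Mon.Hom.ext (unitRight_comp h)
  assoc := by
    refine Mon.Hom.ext (comp_assoc h _ _ ?_ ?_ ?_ ?_)
    · exact congrArg Mon.Hom.hom (M.reflGraph.oneBoxComp_p₁ pb.mon (comp h) _)
    · exact congrArg Mon.Hom.hom (M.reflGraph.oneBoxComp_p₂ pb.mon (comp h) _)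
    · exact congrArg Mon.Hom.hom (M.reflGraph.compBoxOne_p₁ pb.mon (comp h) _)
    · exact congrArg Mon.Hom.hom (M.reflGraph.compBoxOne_p₂ pb.mon (comp h) _)

end Composition

end CrossedData

/-! ### Relative functors -/

namespace RelCat

variable {D : Type u} [Category.{v} D] {T : SpanClass D} [IsAdmissible T]
  (pb : ChosenRelPullbacks T) {G H : ReflGraph T} (b : G.B ⟶ H.B) (a : G.A ⟶ H.A)
  (hs : a ≫ H.s = G.s ≫ b) (ht : a ≫ H.t = G.t ≫ b)

theorem mapAA_p₁ : mapAA pb b a hs ht ≫ H.p₁ pb H.selfOver = G.p₁ pb G.selfOver ≫ a := by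
  rw [mapAA, ReflGraph.boxLift_p₁]

theorem mapAA_p₂ : mapAA pb b a hs ht ≫ H.p₂ pb H.selfOver = G.p₂ pb G.selfOver ≫ a := by
  rw [mapAA, ReflGraph.boxLift_p₂]

theorem oneBox_mapAA (hi : b ≫ H.i = G.i ≫ a) :
    G.oneBox pb G.selfOver ≫ mapAA pb b a hs ht = a ≫ H.oneBox pb H.selfOver := by
  apply H.box_hom_ext pb
  · rw [Category.assoc, mapAA_p₁, ← Category.assoc, ReflGraph.oneBox_p₁, Category.assoc,
      ReflGraph.oneBox_p₁, Category.id_comp, Category.comp_id]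
  · rw [Category.assoc, mapAA_p₂, ← Category.assoc, ReflGraph.oneBox_p₂, Category.assoc,
      Category.assoc, ReflGraph.oneBox_p₂, ← hi, reassoc_of% hs]

theorem boxOne_mapAA (hi : b ≫ H.i = G.i ≫ a) :
    G.boxOne pb G.selfOver ≫ mapAA pb b a hs ht = a ≫ H.boxOne pb H.selfOver := by
  apply H.box_hom_ext pb
  · rw [Category.assoc, mapAA_p₁, ← Category.assoc, ReflGraph.boxOne_p₁, Category.assoc,
      Category.assoc, ReflGraph.boxOne_p₁, ← hi, reassoc_of% ht]
  · rw [Category.assoc, mapAA_p₂, ← Category.assoc, ReflGraph.boxOne_p₂, Category.assoc,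
      ReflGraph.boxOne_p₂]
    exact (Category.id_comp _).trans (Category.comp_id _).symm

variable {pb}

/-- The inverses of the components of a relative functor form a relative functor. -/
theorem isIso_of_components {G H : RelCat pb} (F : G ⟶ H) [IsIso F.b] [IsIso F.a] : IsIso F := by
  have hs : inv F.a ≫ G.s = H.s ≫ inv F.b := by
    rw [IsIso.inv_comp_eq, ← Category.assoc, IsIso.eq_comp_inv, F.comm_s]
  have ht : inv F.a ≫ G.t = H.t ≫ inv F.b := by
    rw [IsIso.inv_comp_eq, ← Category.assoc, IsIso.eq_comp_inv, F.comm_t]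
  have e : mapAA pb (inv F.b) (inv F.a) hs ht ≫ mapAA pb F.b F.a F.comm_s F.comm_t = 𝟙 _ := by
    apply H.box_hom_ext pb
    · rw [Category.assoc, mapAA_p₁, ← Category.assoc, mapAA_p₁, Category.assoc,
        IsIso.inv_hom_id, Category.comp_id, Category.id_comp]
    · rw [Category.assoc, mapAA_p₂, ← Category.assoc, mapAA_p₂, Category.assoc,
        IsIso.inv_hom_id, Category.id_comp]
      exact Category.comp_id _
  refine ⟨⟨inv F.b, inv F.a, hs, ht, ?_, ?_⟩, ?_, ?_⟩
  · rw [IsIso.inv_comp_eq, ← Category.assoc, IsIso.eq_comp_inv, F.comm_i]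
  · rw [IsIso.comp_inv_eq, Category.assoc, F.comm_d, ← Category.assoc, e, Category.id_comp]
  · exact Hom.ext_of (IsIso.hom_inv_id F.b) (IsIso.hom_inv_id F.a)
  · exact Hom.ext_of (IsIso.inv_hom_id F.b) (IsIso.inv_hom_id F.a)

end RelCat

/-! ### Functoriality in the crossed module -/

namespace CrossedData

section HomFromYB

variable {M N : CrossedData S}

theorem hom_eq_extMul {A : Mon C} (h : M.YB ⟶ A) :
    h.hom = (M.inl.hom ≫ h.hom) ⋆ (M.inr.hom ≫ h.hom) :=
  ((congrArg (fun z => z ≫ h.hom) M.inl_extMul_inr).trans (Category.id_comp _)).symm.trans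
    (extMul_comp_hom M.inl.hom M.inr.hom h)

/-- The monoid `Y B` is generated by `Y` and `B`. -/
theorem YB_hom_ext {A : Mon C} {h k : M.YB ⟶ A}
    (h₁ : M.inl.hom ≫ h.hom = M.inl.hom ≫ k.hom) (h₂ : M.inr.hom ≫ h.hom = M.inr.hom ≫ k.hom) :
    h = k := by
  apply Mon.Hom.ext
  rw [hom_eq_extMul h, hom_eq_extMul k, h₁, h₂]

theorem inl_desc {A : Mon C} (p : M.Y ⟶ A) (j : M.B ⟶ A)
    (hx : M.x ≫ (p.hom ⋆ j.hom) = j.hom ⋆ p.hom) : M.inl.hom ≫ (M.desc p j hx).hom = p.hom :=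
  extMul_one_inv p.hom j.hom

theorem inr_desc {A : Mon C} (p : M.Y ⟶ A) (j : M.B ⟶ A)
    (hx : M.x ≫ (p.hom ⋆ j.hom) = j.hom ⋆ p.hom) : M.inr.hom ≫ (M.desc p j hx).hom = j.hom :=
  one_extMul_inv p.hom j.hom

theorem inl_eB_hom : M.inl.hom ≫ M.eB.hom = M.e ≫ η[M.B.X] := M.inl_eB

theorem inr_eB_hom : M.inr.hom ≫ M.eB.hom = 𝟙 M.B.X := M.inr_eB

theorem inl_kB_hom : M.inl.hom ≫ M.kB.hom = M.k := M.inl_kB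

theorem inr_kB_hom : M.inr.hom ≫ M.kB.hom = 𝟙 M.B.X := M.inr_kB

/-- The morphism of monoids `y b : Y B ⟶ Y' B'` induced by a morphism of crossed modules. -/
def Hom.mapYB (F : Hom M N) : M.YB ⟶ N.YB :=
  M.desc (F.y ≫ N.inl) (F.b ≫ N.inr) (by
    have h₁ : (F.y.hom ⊗ₘ F.b.hom) ≫ (N.inl.hom ⋆ N.inr.hom) =
      (F.y.hom ≫ N.inl.hom) ⋆ (F.b.hom ≫ N.inr.hom) := tensorHom_extMul ..
    have h₂ : (F.b.hom ⊗ₘ F.y.hom) ≫ (N.inr.hom ⋆ N.inl.hom) =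
      (F.b.hom ≫ N.inr.hom) ⋆ (F.y.hom ≫ N.inl.hom) := tensorHom_extMul ..
    rw [Mon.comp_hom', Mon.comp_hom', ← h₁, ← h₂, inr_extMul_inl]
    refine Eq.trans ?_ F.comm_x.symm
    refine congrArg (fun z => M.x ≫ z) ?_
    rw [inl_extMul_inr]
    exact Category.comp_id _)

variable (F : Hom M N)

theorem Hom.inl_mapYB : M.inl.hom ≫ F.mapYB.hom = F.y.hom ≫ N.inl.hom := inl_desc ..

theorem Hom.inr_mapYB : M.inr.hom ≫ F.mapYB.hom = F.b.hom ≫ N.inr.hom := inr_desc ..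

theorem Hom.mapYB_eB : F.mapYB ≫ N.eB = M.eB ≫ F.b := by
  apply YB_hom_ext
  · rw [Mon.comp_hom', ← Category.assoc, F.inl_mapYB, Category.assoc, inl_eB_hom,
      ← Category.assoc, F.comm_e, Mon.comp_hom', ← Category.assoc, inl_eB_hom, Category.assoc,
      IsMonHom.one_hom]
  · rw [Mon.comp_hom', ← Category.assoc, F.inr_mapYB, Category.assoc, inr_eB_hom, Mon.comp_hom',
      ← Category.assoc, inr_eB_hom, Category.comp_id, Category.id_comp]

theorem Hom.mapYB_kB : F.mapYB ≫ N.kB = M.kB ≫ F.b := by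
  apply YB_hom_ext
  · rw [Mon.comp_hom', ← Category.assoc, F.inl_mapYB, Category.assoc, inl_kB_hom, F.comm_k,
      Mon.comp_hom', ← Category.assoc, inl_kB_hom]
  · rw [Mon.comp_hom', ← Category.assoc, F.inr_mapYB, Category.assoc, inr_kB_hom, Mon.comp_hom',
      ← Category.assoc, inr_kB_hom, Category.comp_id, Category.id_comp]

theorem Hom.mapYB_id (M : CrossedData S) : (Hom.id M).mapYB = 𝟙 M.YB := by
  apply YB_hom_ext
  · rw [Hom.inl_mapYB]
    exact (Category.id_comp _).trans (Category.comp_id _).symm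
  · rw [Hom.inr_mapYB]
    exact (Category.id_comp _).trans (Category.comp_id _).symm

theorem Hom.mapYB_comp {L : CrossedData S} (F' : Hom N L) :
    (Hom.comp F F').mapYB = F.mapYB ≫ F'.mapYB := by
  apply YB_hom_ext
  · rw [Hom.inl_mapYB, Mon.comp_hom', ← Category.assoc, F.inl_mapYB, Category.assoc,
      F'.inl_mapYB]
    exact Category.assoc _ _ _
  · rw [Hom.inr_mapYB, Mon.comp_hom', ← Category.assoc, F.inr_mapYB, Category.assoc,
      F'.inr_mapYB]
    exact Category.assoc _ _ _

section ReflGraphHom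

variable {pb : ChosenRelPullbacks S} (H : RelCat pb.mon) (b : M.B ⟶ H.B) (a : M.YB ⟶ H.A)
  (hs : a ≫ H.s = M.eB ≫ b) (ht : a ≫ H.t = M.kB ≫ b)

/-- The morphism `a □ a : (Y B) □_B (Y B) ⟶ A □_B A`. -/
noncomputable def mapAA : M.AA pb ⟶ H.AA pb.mon :=
  RelCat.mapAA pb.mon (G := M.reflGraph) (H := H.toReflGraph) b a hs ht

theorem left_mapAA_d (hi : b ≫ H.i = M.inr ≫ a) :
    M.left pb ≫ mapAA H b a hs ht ≫ H.d = M.inl ≫ a := by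
  have h₁ : M.unitRight pb ≫ mapAA H b a hs ht =
      a ≫ H.oneBox pb.mon H.selfOver :=
    RelCat.oneBox_mapAA pb.mon (G := M.reflGraph) (H := H.toReflGraph) b a hs ht hi
  rw [left, Category.assoc, reassoc_of% h₁, H.unit_right, Category.comp_id]

theorem right_mapAA_d (hi : b ≫ H.i = M.inr ≫ a) :
    M.right pb ≫ mapAA H b a hs ht ≫ H.d = a := by
  have h₁ : M.right pb ≫ mapAA H b a hs ht = a ≫ H.boxOne pb.mon H.selfOver :=
    RelCat.boxOne_mapAA pb.mon (G := M.reflGraph) (H := H.toReflGraph) b a hs ht hi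
  rw [reassoc_of% h₁, H.unit_left]
  exact Category.comp_id a

/-- The composition of `H` is a morphism of monoids and satisfies the unit laws, which determines its
values on the products that are described by `b₂`. -/
theorem bYB_mapAA_d (hi : b ≫ H.i = M.inr ≫ a) :
    M.bYB pb ≫ (mapAA H b a hs ht ≫ H.d).hom = M.act ≫ a.hom := by
  have h₁ := congrArg Mon.Hom.hom (left_mapAA_d H b a hs ht hi)
  have h₂ := congrArg Mon.Hom.hom (right_mapAA_d H b a hs ht hi)
  rw [Mon.comp_hom'] at h₁ h₂
  rw [bYB_eq, extMul_comp_hom, h₁, h₂, act, extMul_comp_hom, Category.id_comp, Mon.comp_hom']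

/-- A morphism of reflexive graphs from the relative category of a crossed module automatically
preserves the composition, because the latter is determined by the units and by the monoid
structures. -/
noncomputable def relFunctor (hM : IsCrossedModule pb M) (hi : b ≫ H.i = M.inr ≫ a) :
    relCat hM ⟶ H where
  b := b
  a := a
  comm_s := hs
  comm_t := ht
  comm_i := hi
  comm_d := by
    have := isIso_bYB hM
    refine Mon.Hom.ext ((cancel_epi (M.bYB pb)).1 ?_)
    refine Eq.trans ?_ (bYB_mapAA_d H b a hs ht hi).symm
    exact (Category.assoc _ _ _).symm.trans (congrArg (fun z => z ≫ a.hom) (bYB_comp hM))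

end ReflGraphHom

variable {pb : ChosenRelPullbacks S}

/-- The functor between relative categories that is induced by a morphism of crossed modules. -/
noncomputable def Hom.relFunctor (hM : IsCrossedModule pb M) (hN : IsCrossedModule pb N) :
    relCat hM ⟶ relCat hN :=
  CrossedData.relFunctor (relCat hN) F.b F.mapYB F.mapYB_eB F.mapYB_kB hM
    (Mon.Hom.ext F.inr_mapYB.symm)

/-- Uniqueness in the universal property that invertibility of `f` gives to `Y`. -/
theorem Y_hom_ext (hf : IsIso (M.f pb)) {X : C} {h k : X ⟶ M.Y.X}
    (h₁ : h ≫ M.inl.hom = k ≫ M.inl.hom) (h₂ : h ≫ M.e = k ≫ M.e) : h = k := by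
  rw [← cancel_mono (M.f pb)]
  apply pb.hom_ext
  · rw [Category.assoc, f_fst, Category.assoc, f_fst]
    exact h₁
  · rw [Category.assoc, f_snd, Category.assoc, f_snd]
    exact h₂

/-- Existence in the universal property that invertibility of `f` gives to `Y`: it is a relative
pullback of `e 1 : Y B ⟶ B` and `u : I ⟶ B`. -/
theorem exists_lift_Y (hf : IsIso (M.f pb)) {X : C} (a : X ⟶ M.YB.X) (c : X ⟶ 𝟙_ C)
    (hac : S a c) (w : a ≫ M.eB.hom = c ≫ η[M.B.X]) :
    ∃ h : X ⟶ M.Y.X, h ≫ M.inl.hom = a ∧ h ≫ M.e = c := by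
  refine ⟨pb.lift M.mem_eOne (mem_of_unit _ _) a c hac w ≫ inv (M.f pb), ?_, ?_⟩
  · refine Eq.trans ?_ (pb.lift_fst M.mem_eOne (mem_of_unit _ _) a c hac w)
    rw [Category.assoc]
    refine congrArg (fun z => _ ≫ z) ((IsIso.inv_comp_eq _).2 (M.f_fst pb).symm)
  · refine Eq.trans ?_ (pb.lift_snd M.mem_eOne (mem_of_unit _ _) a c hac w)
    rw [Category.assoc]
    refine congrArg (fun z => _ ≫ z) ((IsIso.inv_comp_eq _).2 (M.f_snd pb).symm)

/-- Every pair of morphisms of monoids that is compatible with `s`, `t`, `i` comes from a morphism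
of crossed modules. -/
theorem exists_hom_of_mapYB (hf : IsIso (N.f pb)) (b : M.B ⟶ N.B) (a : M.YB ⟶ N.YB)
    (hs : a ≫ N.eB = M.eB ≫ b) (ht : a ≫ N.kB = M.kB ≫ b) (hi : b ≫ N.inr = M.inr ≫ a) :
    ∃ F : Hom M N, F.b = b ∧ F.mapYB = a := by
  have hs' : a.hom ≫ N.eB.hom = M.eB.hom ≫ b.hom := congrArg Mon.Hom.hom hs
  have ht' : a.hom ≫ N.kB.hom = M.kB.hom ≫ b.hom := congrArg Mon.Hom.hom ht
  have hi' : b.hom ≫ N.inr.hom = M.inr.hom ≫ a.hom := congrArg Mon.Hom.hom hi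
  have := M.e_isMonHom
  have := N.e_isMonHom
  obtain ⟨y, hy, hye⟩ := exists_lift_Y hf (M.inl.hom ≫ a.hom) M.e
    (by
      have h := IsAdmissible.post M.mem_e (M.inl.hom ≫ a.hom) (𝟙 _)
      rwa [Category.id_comp, Category.comp_id] at h)
    (by rw [Category.assoc, hs', ← Category.assoc, inl_eB_hom, Category.assoc, IsMonHom.one_hom])
  have hy₁ : IsMonHom y := by
    constructor
    · apply Y_hom_ext hf
      · rw [Category.assoc, hy, ← Category.assoc, IsMonHom.one_hom, IsMonHom.one_hom,
          IsMonHom.one_hom]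
      · rw [Category.assoc, hye, IsMonHom.one_hom, IsMonHom.one_hom]
    · apply Y_hom_ext hf
      · rw [Category.assoc, hy, ← Category.assoc, mul_comp, extMul_comp_hom, Category.assoc,
          mul_comp, tensorHom_extMul, hy]
      · rw [Category.assoc, hye, mul_comp, Category.assoc, mul_comp, tensorHom_extMul, hye]
  have ha : a.hom = (y ≫ N.inl.hom) ⋆ (b.hom ≫ N.inr.hom) := by
    rw [hy, hi']
    exact hom_eq_extMul a
  have hk : y ≫ N.k = M.k ≫ b.hom := by
    rw [← inl_kB_hom, ← Category.assoc, hy, Category.assoc, ht', ← Category.assoc, inl_kB_hom]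
  have hx : (b.hom ⊗ₘ y) ≫ N.x = M.x ≫ (y ⊗ₘ b.hom) := by
    have h₁ : (y ⊗ₘ b.hom) ≫ (N.inl.hom ⋆ N.inr.hom) = a.hom := by rw [tensorHom_extMul, ha]
    have h₂ : (b.hom ⊗ₘ y) ≫ (N.inr.hom ⋆ N.inl.hom) = (M.inr.hom ⋆ M.inl.hom) ≫ a.hom := by
      rw [tensorHom_extMul, hy, hi', extMul_comp_hom]
    rw [inr_extMul_inl, inr_extMul_inl, ← h₁, inl_extMul_inr] at h₂
    exact h₂.trans (congrArg (fun z => M.x ≫ z) (Category.comp_id _))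
  refine ⟨⟨b, ⟨y⟩, hye, hk, hx⟩, rfl, ?_⟩
  apply Mon.Hom.ext
  rw [ha]
  rfl

end HomFromYB

end CrossedData

/-! ### The functor from crossed modules to relative categories -/

variable (pb : ChosenRelPullbacks S)

/-- The functor from crossed modules to relative categories with invertible morphisms `q_n`. -/
noncomputable def xmodToCatMon : Xmod pb ⥤ CatMon pb where
  obj N := ⟨CrossedData.relCat N.property,
    N.obj.isIso_q pb N.property.f_isIso N.property.b_isIso⟩
  map {M N} F := ObjectProperty.homMk (F.hom.relFunctor M.property N.property)
  map_id M := ObjectProperty.hom_ext _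
    (RelCat.Hom.ext_of rfl (CrossedData.Hom.mapYB_id M.obj))
  map_comp F F' := ObjectProperty.hom_ext _
    (RelCat.Hom.ext_of rfl (F.hom.mapYB_comp F'.hom))

instance : (xmodToCatMon pb).Faithful where
  map_injective {M N F F'} h := by
    have h' : F.hom.relFunctor M.property N.property = F'.hom.relFunctor M.property N.property :=
      congrArg InducedCategory.Hom.hom h
    have hb : F.hom.b = F'.hom.b := congrArg RelCat.Hom.b h'
    have ha : F.hom.mapYB = F'.hom.mapYB := congrArg RelCat.Hom.a h'
    refine ObjectProperty.hom_ext _ (CrossedData.Hom.ext_of hb (Mon.Hom.ext ?_))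
    apply CrossedData.Y_hom_ext N.property.f_isIso
    · rw [← F.hom.inl_mapYB, ha, F'.hom.inl_mapYB]
    · rw [F.hom.comm_e, F'.hom.comm_e]

instance : (xmodToCatMon pb).Full where
  map_surjective {M N} K := by
    obtain ⟨F, hb, ha⟩ := CrossedData.exists_hom_of_mapYB N.property.f_isIso K.hom.b K.hom.a
      K.hom.comm_s K.hom.comm_t K.hom.comm_i
    exact ⟨ObjectProperty.homMk F, ObjectProperty.hom_ext _ (RelCat.Hom.ext_of hb ha)⟩

variable {pb}

/-! ### The crossed module of a relative category -/

namespace RelCat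

section Data

variable (G : ReflGraph (monSpan S))

theorem mem_pA_t : S ((pA pb G).hom ≫ G.t.hom) (𝟙 (AI pb G).X) := by
  refine (isRelPullback_AI pb G).reflect_right _ _ ?_ ?_
  · have h := IsAdmissible.pre (right_leg G.mem_t) (pA pb G).hom
    rw [Category.comp_id] at h
    rwa [Category.id_comp]
  · have h := IsAdmissible.post (isRelPullback_AI pb G).mem G.t.hom (𝟙 _)
    rw [Category.comp_id] at h
    rwa [Category.id_comp]

theorem mem_pI : S (𝟙 (AI pb G).X) (pI pb G) := by
  refine (isRelPullback_AI pb G).reflect_left _ _ ?_ ?_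
  · rw [Category.id_comp]
    exact (isRelPullback_AI pb G).mem
  · rw [Category.id_comp]
    have h := IsAdmissible.pre (IsMonoidalClass.unital (S := S)) (pI pb G)
    rwa [Category.comp_id] at h

theorem qOne_s : qOne pb G ≫ G.s.hom = pI pb G ▷ G.B.X ≫ (λ_ G.B.X).hom := by
  rw [qOne_eq, extMul_comp_hom, pA_s, i_s_hom, ← whiskerRight_extMul, one_extMul, Category.comp_id]

theorem qOne_t : qOne pb G ≫ G.t.hom = ((pA pb G).hom ≫ G.t.hom) ▷ G.B.X ≫ μ[G.B.X] := by
  rw [qOne_eq, extMul_comp_hom, i_t_hom, extMul, tensorHom_id]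

theorem mul_s : (G.i.hom ⋆ (pA pb G).hom) ≫ G.s.hom = G.B.X ◁ pI pb G ≫ (ρ_ G.B.X).hom := by
  rw [extMul_comp_hom, pA_s, i_s_hom, ← whiskerLeft_extMul, extMul_one, Category.comp_id]

theorem mul_t : (G.i.hom ⋆ (pA pb G).hom) ≫ G.t.hom =
    G.B.X ◁ ((pA pb G).hom ≫ G.t.hom) ≫ μ[G.B.X] := by
  rw [extMul_comp_hom, i_t_hom, extMul, id_tensorHom]

end Data

section CrossedModule

variable {G : ReflGraph (monSpan S)} (hq : IsIso (qOne pb G))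

theorem inv_qOne_comp : ((G.i.hom ⋆ (pA pb G).hom) ≫ inv (qOne pb G)) ≫ qOne pb G =
    G.i.hom ⋆ (pA pb G).hom := by
  rw [Category.assoc, IsIso.inv_hom_id, Category.comp_id]

/-- The data of a crossed module of a reflexive graph of monoids with invertible `q₁`: the monoid
`Y` is `A □_B I` and the distributive law is transported from the multiplication of `A`. -/
noncomputable def crossedData : CrossedData S where
  B := G.B
  Y := AI pb G
  e := pI pb G
  e_isMonHom := isMonHom_pI pb G
  k := (pA pb G).hom ≫ G.t.hom
  k_isMonHom := (pA pb G ≫ G.t).isMonHom_hom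
  x := (G.i.hom ⋆ (pA pb G).hom) ≫ inv (qOne pb G)
  distributive := haveI : Mono ((pA pb G).hom ⋆ G.i.hom) := inferInstanceAs (Mono (qOne pb G))
    isDistributiveLaw_of_extMul (pA pb G).hom G.i.hom (inv_qOne_comp hq)
  mem_k := mem_pA_t G
  mem_e := mem_pI G
  mem_B := G.mem_id
  x_e := by rw [← qOne_s, ← Category.assoc, inv_qOne_comp, mul_s]
  x_k := by rw [← qOne_t, ← Category.assoc, inv_qOne_comp, mul_t]

/-- The morphism `q₁ : Y B ⟶ A` as a morphism of monoids. -/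
noncomputable def qHom : (crossedData hq).YB ⟶ G.A :=
  (crossedData hq).desc (pA pb G) G.i (inv_qOne_comp hq)

theorem isIso_qHom : IsIso (qHom hq) := by
  have : IsIso ((Mon.forget C).map (qHom hq)) := hq
  exact isIso_of_reflects_iso (qHom hq) (Mon.forget C)

theorem inl_qHom : (crossedData hq).inl ≫ qHom hq = pA pb G :=
  Mon.Hom.ext (CrossedData.inl_desc ..)

theorem inr_qHom : (crossedData hq).inr ≫ qHom hq = G.i :=
  Mon.Hom.ext (CrossedData.inr_desc ..)

theorem qHom_s : qHom hq ≫ G.s = (crossedData hq).eB ≫ 𝟙 G.B :=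
  Mon.Hom.ext ((qOne_s G).trans (Category.comp_id _).symm)

theorem qHom_t : qHom hq ≫ G.t = (crossedData hq).kB ≫ 𝟙 G.B := by
  refine Mon.Hom.ext ((qOne_t G).trans (Eq.trans ?_ (Category.comp_id _).symm))
  rw [← tensorHom_id]
  rfl

/-- The comparison of a reflexive graph with its associated data of a crossed module. -/
noncomputable def comparison : Comparison pb (crossedData hq) G where
  β := 𝟙 G.B
  φ := 𝟙 (AI pb G).X
  φ_pI := Category.id_comp _
  φ_t := (Category.id_comp _).trans (Category.comp_id _).symm

theorem isIso_b (h : ∀ n, IsIso (q pb G n)) (n : ℕ) : IsIso ((crossedData hq).b pb n) := by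
  have h₁ : IsIso (comparison hq).β.hom := inferInstanceAs (IsIso (𝟙 G.B.X))
  have h₂ : IsIso (comparison hq).φ := inferInstanceAs (IsIso (𝟙 (AI pb G).X))
  exact (comparison hq).isIso_b_of_q h n

/-- Up to the isomorphism induced by `q₁`, the morphism `f` is the identity of `A □_B I`. -/
theorem isIso_f : IsIso ((crossedData hq).f pb) := by
  have hs : (qHom hq).hom ≫ G.s.hom = (crossedData hq).eOne G.B.X ≫ 𝟙 G.B.X :=
    congrArg Mon.Hom.hom (qHom_s hq)
  have h₁ : IsIso (qHom hq).hom := hq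
  -- The morphism of cospans `(q₁, 1, 1)` induces an isomorphism `(Y B) □_B I ≅ A □_B I = Y`.
  let r := pb.map (crossedData hq).mem_eOne (mem_of_unit η[G.B.X] (𝟙 (𝟙_ C))) (left_leg G.mem_s)
    (right_leg (mem_unit G.B)) (qHom hq).hom (𝟙 (𝟙_ C)) (𝟙 G.B.X) hs
    ((Category.id_comp _).trans (Category.comp_id _).symm)
  have hr : IsIso r := @ChosenRelPullbacks.isIso_map _ _ _ _ pb _ _ _ _ _ _ _ _ _ _ _ _ _ _
    (qHom hq).hom (𝟙 (𝟙_ C)) (𝟙 G.B.X) _ _ h₁ (IsIso.id _) (IsIso.id _)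
  have e : (crossedData hq).f pb ≫ r = 𝟙 (AI pb G).X := by
    apply (isRelPullback_AI pb G).hom_ext
    · refine (Category.assoc _ _ _).trans ?_
      refine (congrArg (fun z => (crossedData hq).f pb ≫ z) (pb.map_fst ..)).trans ?_
      refine (Category.assoc _ _ _).symm.trans ?_
      refine (congrArg (fun z => z ≫ (qHom hq).hom) ((crossedData hq).f_fst pb)).trans ?_
      exact (congrArg Mon.Hom.hom (inl_qHom hq)).trans (Category.id_comp _).symm
    · refine (Category.assoc _ _ _).trans ?_
      refine (congrArg (fun z => (crossedData hq).f pb ≫ z) (pb.map_snd ..)).trans ?_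
      refine (Category.assoc _ _ _).symm.trans ?_
      refine (congrArg (fun z => z ≫ 𝟙 (𝟙_ C)) ((crossedData hq).f_snd pb)).trans ?_
      exact (Category.comp_id _).trans (Category.id_comp _).symm
  have he : IsIso ((crossedData hq).f pb ≫ r) := by
    rw [e]
    exact inferInstanceAs (IsIso (𝟙 (AI pb G).X))
  exact @IsIso.of_isIso_comp_right _ _ _ _ _ _ r hr he

end CrossedModule

variable (G : RelCat pb.mon) (h : qInvertible pb G)

/-- The Peiffer condition holds because, transported along `q₁`, the composite in `peiffer_iff` is the
composition of `G`, which is a morphism of monoids. -/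
theorem isCrossedModule : IsCrossedModule pb (crossedData (h 0)) where
  f_isIso := isIso_f (h 0)
  b_isIso := isIso_b (h 0) h
  peiffer := by
    set M := crossedData (h 0)
    have hb : IsIso (M.bYB pb) := isIso_b (h 0) h 1
    have hs := qHom_s (h 0)
    have ht := qHom_t (h 0)
    have hi : 𝟙 G.B ≫ G.i = M.inr ≫ qHom (h 0) := (Category.id_comp _).trans (inr_qHom (h 0)).symm
    have hq : IsIso (qHom (h 0)).hom := h 0
    refine (M.peiffer_iff pb).2 ?_
    have e₁ := congrArg Mon.Hom.hom (CrossedData.left_mapAA_d (M := M) G (𝟙 G.B) _ hs ht hi)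
    have e₂ := congrArg Mon.Hom.hom (CrossedData.right_mapAA_d (M := M) G (𝟙 G.B) _ hs ht hi)
    have e₃ := CrossedData.bYB_mapAA_d (M := M) G (𝟙 G.B) _ hs ht hi
    rw [← IsIso.eq_inv_comp] at e₃
    rw [← cancel_mono (qHom (h 0)).hom, Category.assoc, Category.assoc, ← e₃, extMul_comp_hom,
      extMul_comp_hom, Category.id_comp]
    rw [Mon.comp_hom'] at e₁ e₂
    rw [e₁, e₂, Mon.comp_hom']

/-- The functor `(1, q₁)` from the relative category of the crossed module of `G` to `G`. -/
noncomputable def counit : CrossedData.relCat (isCrossedModule G h) ⟶ G :=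
  CrossedData.relFunctor G (𝟙 G.B) (qHom (h 0)) (qHom_s (h 0)) (qHom_t (h 0))
    (isCrossedModule G h) ((Category.id_comp _).trans (inr_qHom (h 0)).symm)

theorem isIso_counit : IsIso (counit G h) := by
  have : IsIso (counit G h).b := inferInstanceAs (IsIso (𝟙 G.B))
  have : IsIso (counit G h).a := isIso_qHom (h 0)
  exact isIso_of_components _

end RelCat

instance : (xmodToCatMon pb).EssSurj where
  mem_essImage G :=
    ⟨⟨_, RelCat.isCrossedModule G.obj G.property⟩,
      ⟨(qInvertible pb).isoMk (@asIso _ _ _ _ (RelCat.counit G.obj G.property)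
        (RelCat.isIso_counit G.obj G.property))⟩⟩

instance : (xmodToCatMon pb).IsEquivalence where

end Monoids

end RelXmod

theorem theorem3p10 {C : Type u} [Category.{v} C] [MonoidalCategory C]
    (S : RelXmod.SpanClass C) [RelXmod.IsAdmissible S] [RelXmod.IsMonoidalClass S]
    (pb : RelXmod.ChosenRelPullbacks S) :
    Nonempty (RelXmod.CatMon pb ≌ RelXmod.Xmod pb) :=
  ⟨(RelXmod.xmodToCatMon pb).asEquivalence.symm⟩
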